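/- Let $k$ be an algebraically closed field and $n\ge 1$. Let $\Lambda_n$ be the linear radical square zero Nakayama algebra of rank $n$ over $k$, that is, the path algebra of the quiver $1\to 2\to\cdots\to n$ modulo the ideal generated by all paths of length two. A finitely generated indecomposable $\Lambda_n$-module $M$ is called exceptional if $\operatorname{End}_{\Lambda_n}(M)\cong k$ and $\operatorname{Ext}^i_{\Lambda_n}(M,M)=0$ for all $i\ge 1$. A complete exceptional sequence of $\Lambda_n$ is a sequence $(M_1,\dots,M_n)$ of isomorphism classes of exceptional $\Lambda_n$-modules such that $\operatorname{Hom}_{\Lambda_n}(M_j,M_i)=0$ and $\operatorname{Ext}^s_{\Lambda_n}(M_j,M_i)=0$ for all $1\le i<j\le n$ and all $s\ge 1$. Then the number of complete exceptional sequences of $\Lambda_n$ is $$\sum_{j=1}^n\binom{n}{j}\,j^{\,n-j}.$$ This is also the number of idempotent self-maps of an $n$-element set, i.e. of maps $f:\{1,\dots,n\}\to\{1,\dots,n\}$ with $f\circ f=f$. -/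

import Mathlib

/-! ### Exceptional modules and exceptional sequences over an algebra over a field -/

section ExceptionalSequences

open CategoryTheory

universe u

variable (k : Type u) [Field k] {A : Type u} [Ring A] [Algebra k A]

/-- A finitely generated indecomposable `A`-module `M` is exceptional if its endomorphism algebra
is `k` and it has no self-extensions in positive degrees. -/
structure IsExceptional (M : ModuleCat.{u} A) : Prop where
  finite : Module.Finite A M
  indecomposable : Indecomposable M
  end_equiv : Nonempty (End M ≃ₐ[k] k)
  ext_self : ∀ i : ℕ, 1 ≤ i → Subsingleton (Abelian.Ext M M i)

/-- `(M, N)` is an exceptional pair if `M` and `N` are exceptional, `Hom(N, M) = 0` and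
`Ext^i(N, M) = 0` for all `i ≥ 1`. -/
structure IsExceptionalPair (M N : ModuleCat.{u} A) : Prop where
  left : IsExceptional k M
  right : IsExceptional k N
  hom_eq_zero : Subsingleton (N ⟶ M)
  ext_eq_zero : ∀ i : ℕ, 1 ≤ i → Subsingleton (Abelian.Ext N M i)

/-- A sequence `(M_1, …, M_t)` of exceptional modules is exceptional if `(M_i, M_j)` is an
exceptional pair for all `i < j`. -/
structure IsExceptionalSequence {t : ℕ} (M : Fin t → ModuleCat.{u} A) : Prop where
  exceptional : ∀ i, IsExceptional k (M i)
  pair : ∀ i j, i < j → IsExceptionalPair k (M i) (M j)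

variable (A) in
/-- The exceptional sequences of length `t` over `A`, as sequences of isomorphism classes of
`A`-modules. -/
def exceptionalSequences (t : ℕ) :
    Set (Fin t → Quotient (isIsomorphicSetoid (ModuleCat.{u} A))) :=
  {E | ∃ M : Fin t → ModuleCat.{u} A,
    IsExceptionalSequence k M ∧ ∀ i, E i = Quotient.mk (isIsomorphicSetoid _) (M i)}

end ExceptionalSequences

/-! ### The linear radical square zero Nakayama algebra of rank `n` -/

namespace LinearNakayama

universe u

/-- Vertices and arrows of the linear quiver `0 ⟶ 1 ⟶ ⋯ ⟶ n - 1`. -/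
inductive Gen (n : ℕ) : Type
  | vertex (i : Fin n) : Gen n
  | arrow (i j : Fin n) (h : (i : ℕ) + 1 = j) : Gen n

variable (k : Type u) [Field k] (n : ℕ)

/-- The vertex `i` as an element of the free algebra: the trivial path at `i`. -/
abbrev e {n : ℕ} (i : Fin n) : FreeAlgebra k (Gen n) :=
  FreeAlgebra.ι k (Gen.vertex i)

/-- The arrow `i ⟶ j`, `j = i + 1`, as an element of the free algebra. -/
abbrev a {n : ℕ} (i j : Fin n) (h : (i : ℕ) + 1 = j) : FreeAlgebra k (Gen n) :=
  FreeAlgebra.ι k (Gen.arrow i j h)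

/-- The relations of the path algebra of the linear quiver (with paths composed like functions, so
that left modules are representations of the quiver), together with the vanishing of all paths of
length two. -/
inductive Rel : FreeAlgebra k (Gen n) → FreeAlgebra k (Gen n) → Prop
  | idem (i : Fin n) : Rel (e k i * e k i) (e k i)
  | orth (i j : Fin n) (h : i ≠ j) : Rel (e k i * e k j) 0
  | sum : Rel (∑ i : Fin n, e k i) 1
  | source (i j : Fin n) (h : (i : ℕ) + 1 = j) : Rel (a k i j h * e k i) (a k i j h)
  | target (i j : Fin n) (h : (i : ℕ) + 1 = j) : Rel (e k j * a k i j h) (a k i j h)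
  | rad_sq (i j l : Fin n) (h : (i : ℕ) + 1 = j) (h' : (j : ℕ) + 1 = l) :
      Rel (a k j l h' * a k i j h) 0

end LinearNakayama

/-- The linear radical square zero Nakayama algebra `Λ_n` over `k`: the path algebra of the linear
quiver with `n` vertices modulo the ideal generated by the paths of length two. -/
abbrev LinearNakayama (k : Type*) [Field k] (n : ℕ) : Type _ :=
  RingQuot (LinearNakayama.Rel k n)

/-!
The indecomposable modules over the linear radical square zero Nakayama algebra are the simple
modules `S_i` and, for each arrow `i ⟶ i + 1`, the projective module `P_i` with top `S_i` and socle
`S_{i+1}`; they are labelled by `Gen n`. Instead of classifying all indecomposable modules, it is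
enough to classify the modules `M` with `End M = k` (`exists_iso_indec`): a nonzero vector at a
vertex, or a vector not annihilated by an arrow, yields an endomorphism of `M` that fixes a nonzero
vector and has image `S_i` or `P_i`; being a scalar, it is the identity.

The sequences `0 ⟶ S_{i+1} ⟶ P_i ⟶ S_i ⟶ 0`, whose middle terms are projective, give all
extensions by dimension shifting in the first variable. Hence some `Ext^s(Y, X)`, `s ≥ 0`, is
nonzero exactly in the following cases (`nonOrth_iff_ext`): `Y = S_i` and `X = S_j` with `i ≤ j`;
`Y = S_{j+1}` and `X = P_j`; `Y = P_i` and `X = S_i`; `Y = P_i` and `X = P_i` or `X = P_{i-1}`. So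
complete exceptional sequences are the sequences of `n` labels in which no label occurs before
another one to which it is not orthogonal (`validSequences`).

These sequences are in bijection with idempotent maps `f : Fin n → Fin n`
(`encard_validSequences`). Sort the positions by the value of `f`, and decreasingly inside each
fibre, and let `v p` be the rank of the position `p`. The sequence attached to `f` has at position
`p` the module `S_{v p}` if `f p = p`, the module `P_{v p - 1}` if `p < f p`, and `P_{v p}` if
`f p < p`. Conversely, in a valid sequence the arrows that occur cut the vertices into
blocks. Two simple modules from the same block would force a cycle among the positions, so, by
counting, each block contains exactly one simple module, and `f` maps a position to the
position of the simple module in its block. Idempotent maps are counted by their sets of fixed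
points (`card_idempotents`).
-/

namespace LinearNakayama

/-! ### Combinatorics of exceptional sequences -/

/-- The top of the indecomposable module attached to `X`, as a natural number. -/
def Gen.src {n : ℕ} : Gen n → ℕ
  | .vertex i => i
  | .arrow i _ _ => i

/-- The socle of the indecomposable module attached to `X`, as a natural number. -/
def Gen.tgt {n : ℕ} : Gen n → ℕ
  | .vertex i => i
  | .arrow _ j _ => j

/-- `NonOrth Y X` is the combinatorial form of the condition that `Ext^s(Y, X) ≠ 0` for some
`s ≥ 0`, where `vertex i` stands for the simple module at `i` and `arrow i j` for the
indecomposable module with top `i` and socle `j`. -/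
def NonOrth {n : ℕ} : Gen n → Gen n → Prop
  | .vertex i, .vertex j => i ≤ j
  | .vertex i, .arrow _ j' _ => i = j'
  | .arrow i _ _, .vertex j => i = j
  | .arrow i _ _, .arrow j j' _ => i = j ∨ i = j'

/-- The sequences of labels of complete exceptional sequences. -/
def validSequences (n : ℕ) : Set (Fin n → Gen n) :=
  {X | ∀ p q, p < q → ¬ NonOrth (X q) (X p)}

lemma Gen.tgt_eq {n : ℕ} (X : Gen n) : X.tgt = X.src ∨ X.tgt = X.src + 1 := by
  cases X with
  | vertex i => exact Or.inl rfl
  | arrow i j h => exact Or.inr h.symm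

lemma Gen.tgt_lt {n : ℕ} (X : Gen n) : X.tgt < n := by
  cases X with
  | vertex i => exact i.2
  | arrow i j h => exact j.2

lemma Gen.ext_src_tgt {n : ℕ} {X Y : Gen n} (hs : X.src = Y.src) (ht : X.tgt = Y.tgt) : X = Y := by
  cases X with
  | vertex i =>
    cases Y with
    | vertex j => exact congrArg _ (Fin.ext hs)
    | arrow j j' h => simp only [Gen.src, Gen.tgt] at hs ht; omega
  | arrow i i' h =>
    cases Y with
    | vertex j => simp only [Gen.src, Gen.tgt] at hs ht; omega
    | arrow j j' h =>
      obtain rfl : i = j := Fin.ext hs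
      obtain rfl : i' = j' := Fin.ext ht
      rfl

lemma nonOrth_iff {n : ℕ} (Y X : Gen n) : NonOrth Y X ↔
    (Y.src = Y.tgt ∧ X.src = X.tgt ∧ Y.src ≤ X.src) ∨ (Y.src = Y.tgt ∧ X.src ≠ X.tgt ∧
      Y.src = X.tgt) ∨ (Y.src ≠ Y.tgt ∧ (Y.src = X.src ∨ X.src ≠ X.tgt ∧ Y.src = X.tgt)) := by
  cases Y <;> cases X <;> simp only [NonOrth, Gen.src, Gen.tgt, Fin.ext_iff, Fin.le_def, true_and,
    ne_eq, not_true_eq_false, false_and, or_false] <;> omega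

lemma Gen.exists_src_tgt {n a b : ℕ} (h : b = a ∨ b = a + 1) (hb : b < n) :
    ∃ X : Gen n, X.src = a ∧ X.tgt = b := by
  rcases h with rfl | rfl
  · exact ⟨.vertex ⟨_, hb⟩, rfl, rfl⟩
  · exact ⟨.arrow ⟨a, by omega⟩ ⟨a + 1, hb⟩ rfl, rfl, rfl⟩

/-- The strict total order attached to a self-map `f`: positions are sorted by the value of `f`,
and decreasingly inside each fibre. -/
def Before {n : ℕ} (f : Fin n → Fin n) (p q : Fin n) : Prop :=
  f p < f q ∨ f p = f q ∧ q < p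

/-- `v` is the rank function of the order `Before f`. -/
structure IsRank {n : ℕ} (f : Fin n → Fin n) (v : Fin n → ℕ) : Prop where
  lt (p : Fin n) : v p < n
  lt_iff (p q : Fin n) : v p < v q ↔ Before f p q

/-- The sequence `X` is the one attached to the self-map `f` with rank function `v`: a position
`p` carries the simple module at `v p` if `f p = p`, the module with socle `v p` if `p < f p`, and
the module with top `v p` if `f p < p`. -/
structure Encodes {n : ℕ} (f : Fin n → Fin n) (v : Fin n → ℕ) (X : Fin n → Gen n) : Prop where
  rank : IsRank f v
  src (p : Fin n) : (X p).src = if p < f p then v p - 1 else v p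
  tgt (p : Fin n) : (X p).tgt = if f p < p then v p + 1 else v p

lemma exists_eq_of_injective {n : ℕ} {v : Fin n → ℕ} (hv : ∀ p, v p < n)
    (hinj : Function.Injective v) {m : ℕ} (hm : m < n) : ∃ p, v p = m := by
  have h : Function.Injective (fun p => (⟨v p, hv p⟩ : Fin n)) := fun p q hpq =>
    hinj (Fin.mk.inj_iff.1 hpq)
  obtain ⟨p, hp⟩ := (Finite.injective_iff_surjective.1 h) ⟨m, hm⟩
  exact ⟨p, congrArg Fin.val hp⟩

lemma before_total {n : ℕ} (f : Fin n → Fin n) (p q : Fin n) :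
    Before f p q ∨ p = q ∨ Before f q p := by
  unfold Before; omega

lemma IsRank.injective {n : ℕ} {f : Fin n → Fin n} {v : Fin n → ℕ} (h : IsRank f v) :
    Function.Injective v := by
  intro p q hpq
  rcases before_total f p q with h1 | h1 | h1
  · have := (h.lt_iff p q).2 h1; omega
  · exact h1
  · have := (h.lt_iff q p).2 h1; omega

lemma exists_isRank {n : ℕ} (f : Fin n → Fin n) : ∃ v, IsRank f v := by
  classical
  have key : ∀ p q, Before f p q → (Finset.univ.filter (fun r => Before f r p)).card <
      (Finset.univ.filter (fun r => Before f r q)).card := by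
    intro p q hpq
    refine Finset.card_lt_card ⟨fun r hr => ?_, fun hsub => ?_⟩
    · simp only [Finset.mem_filter, Finset.mem_univ, true_and] at hr ⊢
      unfold Before at *; omega
    · have := hsub (Finset.mem_filter.2 ⟨Finset.mem_univ p, hpq⟩)
      simp only [Finset.mem_filter, Finset.mem_univ, true_and] at this
      unfold Before at this; omega
  refine ⟨fun p => (Finset.univ.filter (fun r => Before f r p)).card, fun p => ?_, fun p q =>
    ⟨fun h => ?_, key p q⟩⟩
  · have : (Finset.univ.filter (fun r => Before f r p)) ⊂ Finset.univ := by
      refine Finset.ssubset_univ_iff.2 fun hu => ?_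
      have := hu ▸ Finset.mem_univ p
      simp only [Finset.mem_filter, Finset.mem_univ, true_and] at this
      unfold Before at this; omega
    simpa using Finset.card_lt_card this
  · rcases before_total f p q with h1 | rfl | h1
    · exact h1
    · exact absurd h (lt_irrefl _)
    · exact absurd h (key q p h1).le.not_gt

lemma IsRank.unique {n : ℕ} {f : Fin n → Fin n} {v w : Fin n → ℕ} (hv : IsRank f v)
    (hw : IsRank f w) : v = w := by
  have aux : ∀ {v w : Fin n → ℕ}, IsRank f v → IsRank f w → ∀ m p, v p = m → v p ≤ w p := by
    intro v w hv hw m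
    induction m with
    | zero => intro p hp; omega
    | succ m ih =>
      intro p hp
      obtain ⟨r, hr⟩ := exists_eq_of_injective hv.lt hv.injective
        (m := m) (by have := hv.lt p; omega)
      have h1 := ih r hr
      have h2 := (hw.lt_iff r p).2 ((hv.lt_iff r p).1 (by omega))
      omega
  exact funext fun p => le_antisymm (aux hv hw _ p rfl) (aux hw hv _ p rfl)

lemma exists_encodes {n : ℕ} {f : Fin n → Fin n} (hf : ∀ p, f (f p) = f p) :
    ∃ v X, Encodes f v X := by
  obtain ⟨v, hv⟩ := exists_isRank f
  have : ∀ p, ∃ X : Gen n, X.src = (if p < f p then v p - 1 else v p) ∧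
      X.tgt = if f p < p then v p + 1 else v p := by
    intro p
    have h1 := hv.lt_iff p (f p)
    have h2 := hv.lt_iff (f p) p
    have h3 := hv.lt p
    have h4 := hv.lt (f p)
    unfold Before at h1 h2
    rw [hf] at h1 h2
    refine Gen.exists_src_tgt ?_ ?_ <;> split_ifs <;> omega
  choose X hX using this
  exact ⟨v, X, hv, fun p => (hX p).1, fun p => (hX p).2⟩

lemma Encodes.eq {n : ℕ} {f : Fin n → Fin n} {v w : Fin n → ℕ} {X Y : Fin n → Gen n}
    (hX : Encodes f v X) (hY : Encodes f w Y) : X = Y := by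
  obtain rfl := hX.rank.unique hY.rank
  exact funext fun p => Gen.ext_src_tgt (by rw [hX.src, hY.src]) (by rw [hX.tgt, hY.tgt])

lemma Encodes.mem_validSequences {n : ℕ} {f : Fin n → Fin n} {v : Fin n → ℕ} {X : Fin n → Gen n}
    (hf : ∀ p, f (f p) = f p) (hX : Encodes f v X) : X ∈ validSequences n := by
  intro p q hpq
  rw [nonOrth_iff, hX.src, hX.src, hX.tgt, hX.tgt]
  have h0 := fun a b => hX.rank.lt_iff a b
  simp only [Before] at h0
  have h1 := h0 p q
  have h1' := h0 q p
  have h2 := h0 p (f p)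
  have h3 := h0 (f p) p
  have h4 := h0 q (f q)
  have h5 := h0 (f q) q
  have h6 := h0 (f p) (f q)
  have h7 := h0 (f q) (f p)
  have h8 := h0 p (f q)
  have h9 := h0 (f q) p
  have h10 := h0 q (f p)
  have h11 := h0 (f p) q
  simp only [hf, true_and, lt_self_iff_false, false_or] at h2 h3 h4 h5 h6 h7 h8 h9 h10 h11
  rcases lt_trichotomy p (f p) with hp | hp | hp <;> rcases lt_trichotomy q (f q) with hq | hq | hq
  all_goals
    split_ifs <;> omega

/-! ### Orderings forced in a valid sequence -/

/-- `IsSimpleAt X p c`: the module at position `p` is the simple module at `c`. -/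
def IsSimpleAt {n : ℕ} (X : Fin n → Gen n) (p : Fin n) (c : ℕ) : Prop :=
  (X p).src = c ∧ (X p).tgt = c

/-- `IsArrowAt X p c`: the module at position `p` has top `c` and socle `c + 1`. -/
def IsArrowAt {n : ℕ} (X : Fin n → Gen n) (p : Fin n) (c : ℕ) : Prop :=
  (X p).src = c ∧ (X p).tgt = c + 1

/-- The position `p` is linked to the vertex `c` if the simple module at `c` occurs in `X`, and `c`
can be reached from the vertices of `X p` along arrows that occur in `X`. -/
def Link {n : ℕ} (X : Fin n → Gen n) (p : Fin n) (c : ℕ) : Prop :=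
  (∃ q, IsSimpleAt X q c) ∧
    ∀ y, ((X p).src ≤ y ∧ y < c ∨ c ≤ y ∧ y < (X p).tgt) → ∃ r, IsArrowAt X r y

section Valid

variable {n : ℕ} {X : Fin n → Gen n} (hX : X ∈ validSequences n)

include hX

lemma eq_of_src_tgt {p q : Fin n} (hs : (X p).src = (X q).src) (ht : (X p).tgt = (X q).tgt) :
    p = q := by
  have h1 := (X p).tgt_eq
  rcases lt_trichotomy p q with h | h | h
  · have := hX p q h; rw [nonOrth_iff] at this; omega
  · exact h
  · have := hX q p h; rw [nonOrth_iff] at this; omega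

lemma lt_of_nonOrth {p q : Fin n} (h : NonOrth (X p) (X q)) (hne : X p ≠ X q) : p < q := by
  rcases lt_trichotomy p q with h' | h' | h'
  · exact h'
  · exact absurd (congrArg X h') hne
  · exact absurd h (hX q p h')

lemma simple_lt_simple {p q : Fin n} {b c : ℕ} (hp : IsSimpleAt X p b) (hq : IsSimpleAt X q c)
    (h : b < c) : p < q := by
  unfold IsSimpleAt at *
  refine lt_of_nonOrth hX ((nonOrth_iff _ _).2 (by omega)) fun e => ?_
  rw [e] at hp; omega

lemma simple_lt_arrow {p q : Fin n} {c : ℕ} (hp : IsSimpleAt X p (c + 1)) (hq : IsArrowAt X q c) :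
    p < q := by
  unfold IsSimpleAt IsArrowAt at *
  refine lt_of_nonOrth hX ((nonOrth_iff _ _).2 (by omega)) fun e => ?_
  rw [e] at hp; omega

lemma arrow_lt_simple {p q : Fin n} {c : ℕ} (hp : IsArrowAt X p c) (hq : IsSimpleAt X q c) :
    p < q := by
  unfold IsSimpleAt IsArrowAt at *
  refine lt_of_nonOrth hX ((nonOrth_iff _ _).2 (by omega)) fun e => ?_
  rw [e] at hp; omega

lemma arrow_lt_arrow {p q : Fin n} {c : ℕ} (hp : IsArrowAt X p (c + 1)) (hq : IsArrowAt X q c) :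
    p < q := by
  unfold IsArrowAt at *
  refine lt_of_nonOrth hX ((nonOrth_iff _ _).2 (by omega)) fun e => ?_
  rw [e] at hp; omega

/-- If the arrows from `x` to the vertex `c` occur, then the simple module at `c` comes before the
module of the first of these arrows; `d + 1` is the number of arrows. -/
lemma simple_lt_of_chain {q : Fin n} {c : ℕ} (hq : IsSimpleAt X q c) (d : ℕ) :
    ∀ {x : ℕ} {p : Fin n}, IsArrowAt X p x → c = x + d + 1 →
      (∀ y, x ≤ y → y < c → ∃ r, IsArrowAt X r y) → q < p := by
  induction d with
  | zero =>
    rintro x p hp rfl -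
    exact simple_lt_arrow hX hq hp
  | succ d ih =>
    intro x p hp hc hy
    obtain ⟨r, hr⟩ := hy (x + 1) (by omega) (by omega)
    exact (ih hr (by omega) fun y h1 h2 => hy y (by omega) h2).trans (arrow_lt_arrow hX hr hp)

/-- If the arrows starting at `c, …, x` occur, then the module of the last one comes before the
simple module at `c`; `d + 1` is the number of arrows. -/
lemma lt_simple_of_chain {q : Fin n} {c : ℕ} (hq : IsSimpleAt X q c) (d : ℕ) :
    ∀ {x : ℕ} {p : Fin n}, IsArrowAt X p x → x = c + d →
      (∀ y, c ≤ y → y ≤ x → ∃ r, IsArrowAt X r y) → p < q := by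
  induction d with
  | zero =>
    rintro x p hp rfl -
    exact arrow_lt_simple hX hp hq
  | succ d ih =>
    rintro x p hp rfl hy
    obtain ⟨r, hr⟩ := hy (c + d) (by omega) (by omega)
    exact (arrow_lt_arrow hX hp hr).trans (ih hr rfl fun y h1 h2 => hy y h1 (by omega))

/-- Two different simple modules cannot be joined by arrows in a valid sequence: the orderings
forced on the positions would form a cycle. -/
lemma no_chain {q q' : Fin n} {b c : ℕ} (hq : IsSimpleAt X q b) (hq' : IsSimpleAt X q' c)
    (hbc : b < c) (hy : ∀ y, b ≤ y → y < c → ∃ r, IsArrowAt X r y) : False := by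
  obtain ⟨r, hr⟩ := hy b le_rfl hbc
  have h1 := arrow_lt_simple hX hr hq
  have h2 := simple_lt_of_chain hX hq' (c - b - 1) hr (by omega) hy
  have h3 := simple_lt_simple hX hq hq' hbc
  omega

lemma Link.unique {p : Fin n} {b c : ℕ} (hb : Link X p b) (hc : Link X p c) : b = c := by
  have aux : ∀ {b c : ℕ}, Link X p b → Link X p c → ¬ b < c := by
    rintro b c ⟨⟨q, hq⟩, hb⟩ ⟨⟨q', hq'⟩, hc⟩ hbc
    refine no_chain hX hq hq' hbc fun y h1 h2 => ?_
    have := (X p).tgt_eq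
    by_cases h : y < (X p).tgt
    · exact hb y (Or.inr ⟨h1, h⟩)
    · exact hc y (Or.inl ⟨by omega, h2⟩)
  exact le_antisymm (not_lt.1 (aux hc hb)) (not_lt.1 (aux hb hc))

end Valid

/-- In the sequence attached to an idempotent map `f`, each position `p` is linked to the vertex of
the simple module at position `f p`. -/
lemma Encodes.link {n : ℕ} {f : Fin n → Fin n} {v : Fin n → ℕ} {X : Fin n → Gen n}
    (hf : ∀ p, f (f p) = f p) (hX : Encodes f v X) (p : Fin n) :
    IsSimpleAt X (f p) (v (f p)) ∧ Link X p (v (f p)) := by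
  have hs : IsSimpleAt X (f p) (v (f p)) := by simp [IsSimpleAt, hX.src, hX.tgt, hf]
  refine ⟨hs, ⟨_, hs⟩, fun y hy => ?_⟩
  have h0 := fun a b => hX.rank.lt_iff a b
  simp only [Before] at h0
  have h1 := h0 p (f p)
  have h2 := h0 (f p) p
  have hp := hX.rank.lt p
  have hp' := hX.rank.lt (f p)
  rw [hX.src, hX.tgt] at hy
  simp only [hf, true_and, lt_self_iff_false, false_or] at h1 h2
  rcases lt_trichotomy p (f p) with h | h | h
  · rw [if_pos h, if_neg h.asymm] at hy
    -- The positions whose ranks lie between those of `f p` and `p` are in the same fibre.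
    obtain ⟨r, hr⟩ := exists_eq_of_injective hX.rank.lt hX.rank.injective
      (m := y + 1) (by omega)
    have h3 := h0 (f p) r
    have h4 := h0 r p
    have h5 : v r = v p → r = p := fun e => hX.rank.injective e
    simp only [hf] at h3
    refine ⟨r, ?_⟩
    have : r < f r := by
      by_cases e : r = p
      · rwa [e]
      · omega
    simp only [IsArrowAt, hX.src, hX.tgt, if_pos this, if_neg this.asymm]
    omega
  · rw [← h] at hy
    simp only [lt_irrefl, if_false] at hy
    omega
  · rw [if_pos h, if_neg h.asymm] at hy
    obtain ⟨r, hr⟩ := exists_eq_of_injective hX.rank.lt hX.rank.injective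
      (m := y) (by omega)
    have h3 := h0 r (f p)
    have h4 := h0 p r
    have h5 : v p = v r → p = r := fun e => hX.rank.injective e
    simp only [hf] at h3
    refine ⟨r, ?_⟩
    have : f r < r := by
      by_cases e : p = r
      · rwa [← e]
      · omega
    simp only [IsArrowAt, hX.src, hX.tgt, if_pos this, if_neg this.asymm]
    omega

lemma Encodes.eq_map {n : ℕ} {f g : Fin n → Fin n} {v w : Fin n → ℕ} {X : Fin n → Gen n}
    (hf : ∀ p, f (f p) = f p) (hg : ∀ p, g (g p) = g p) (hX : Encodes f v X)
    (hY : Encodes g w X) : f = g := by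
  have hv := hX.mem_validSequences hf
  funext p
  obtain ⟨h1, h2⟩ := hX.link hf p
  obtain ⟨h3, h4⟩ := hY.link hg p
  have h5 := Link.unique hv h2 h4
  exact eq_of_src_tgt hv (by rw [h1.1, h3.1, h5]) (by rw [h1.2, h3.2, h5])

end LinearNakayama

namespace LinearNakayama

/-! ### From exceptional sequences to idempotent maps -/

/-- The vertex assigned to the position `p`, which turns out to be the rank of `p` for the
self-map that encodes a valid sequence `X`. A simple module is assigned its vertex. The module of an
arrow is assigned its top if it is linked to a vertex beyond the top, and its socle otherwise. -/
noncomputable def label {n : ℕ} (X : Fin n → Gen n) (p : Fin n) : ℕ :=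
  open Classical in if ∃ c, (X p).src < c ∧ Link X p c then (X p).src else (X p).tgt

section Valid

variable {n : ℕ} {X : Fin n → Gen n} (hX : X ∈ validSequences n)

lemma label_lt (X : Fin n → Gen n) (p : Fin n) : label X p < n := by
  have h1 := (X p).tgt_lt
  have h2 := (X p).tgt_eq
  unfold label
  split_ifs <;> omega

lemma link_of_eq {p : Fin n} (h : (X p).src = (X p).tgt) : Link X p (X p).src :=
  ⟨⟨p, rfl, h.symm⟩, fun y hy => by omega⟩

/-- A position carries a simple module, or an arrow labelled by its top, or an arrow labelled by its
socle. -/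
lemma label_cases (X : Fin n → Gen n) (p : Fin n) :
    ((X p).tgt = (X p).src ∧ label X p = (X p).src) ∨
    ((X p).tgt = (X p).src + 1 ∧ label X p = (X p).src ∧ ∃ c, (X p).src < c ∧ Link X p c) ∨
    ((X p).tgt = (X p).src + 1 ∧ label X p = (X p).src + 1 ∧
      ¬ ∃ c, (X p).src < c ∧ Link X p c) := by
  rcases (X p).tgt_eq with h | h
  · left
    refine ⟨h, ?_⟩
    unfold label
    split_ifs
    · rfl
    · exact h
  · right
    by_cases hc : ∃ c, (X p).src < c ∧ Link X p c
    · exact Or.inl ⟨h, if_pos hc, hc⟩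
    · exact Or.inr ⟨h, (if_neg hc).trans h, hc⟩

include hX

lemma label_injective : Function.Injective (label X) := by
  -- If the arrow at `q` is labelled by its socle, then nothing at that vertex can be linked to a
  -- vertex beyond the top of `q`: the arrow at `q` would extend the link.
  have aux : ∀ p q, (X q).tgt = (X q).src + 1 → label X q = (X q).src + 1 →
      (¬ ∃ c, (X q).src < c ∧ Link X q c) →
      (X p).src = (X q).src + 1 → (∃ c, (X q).src < c ∧ Link X p c) → False := by
    rintro p q h1 - h3 h4 ⟨c, hc, ⟨r, hr⟩, hy⟩
    refine h3 ⟨c, hc, ⟨r, hr⟩, fun y hy' => ?_⟩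
    by_cases e : y = (X q).src
    · exact ⟨q, e.symm, by omega⟩
    · exact hy y (by omega)
  intro p q hpq
  rcases label_cases X p with ⟨p1, p2⟩ | ⟨p1, p2, c, p3, p4⟩ | ⟨p1, p2, p3⟩ <;>
    rcases label_cases X q with ⟨q1, q2⟩ | ⟨q1, q2, d, q3, q4⟩ | ⟨q1, q2, q3⟩
  · exact eq_of_src_tgt hX (by omega) (by omega)
  · obtain ⟨r, hr⟩ := q4.1
    exact (no_chain hX (q := p) (q' := r) (b := (X q).src) ⟨by omega, by omega⟩ hr q3
      fun y h1 h2 => q4.2 y (by omega)).elim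
  · exact (aux p q q1 q2 q3 (by omega) ⟨_, by omega, link_of_eq (by omega)⟩).elim
  · obtain ⟨r, hr⟩ := p4.1
    exact (no_chain hX (q := q) (q' := r) (b := (X p).src) ⟨by omega, by omega⟩ hr p3
      fun y h1 h2 => p4.2 y (by omega)).elim
  · exact eq_of_src_tgt hX (by omega) (by omega)
  · exact (aux p q q1 q2 q3 (by omega) ⟨c, by omega, p4⟩).elim
  · exact (aux q p p1 p2 p3 (by omega) ⟨_, by omega, link_of_eq (by omega)⟩).elim
  · exact (aux q p p1 p2 p3 (by omega) ⟨d, by omega, q4⟩).elim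
  · exact eq_of_src_tgt hX (by omega) (by omega)

/-- Labels are injective, hence bijective; this forces every position to be linked to the position
of a simple module. -/
lemma exists_link (p : Fin n) : ∃ c, Link X p c := by
  induction h : label X p using Nat.strong_induction_on generalizing p with
  | _ m ih =>
    rcases label_cases X p with ⟨p1, p2⟩ | ⟨p1, p2, c, p3, p4⟩ | ⟨p1, p2, p3⟩
    · exact ⟨_, link_of_eq p1.symm⟩
    · exact ⟨c, p4⟩
    · obtain ⟨r, hr⟩ := exists_eq_of_injective (label_lt X) (label_injective hX)
        (m := (X p).src) (by have := label_lt X p; omega)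
      have hrp : r ≠ p := by rintro rfl; omega
      obtain ⟨c, hc⟩ := ih _ (by omega) r rfl
      rcases label_cases X r with ⟨r1, r2⟩ | ⟨r1, r2, d, r3, r4⟩ | ⟨r1, r2, r3⟩
      · obtain rfl := Link.unique hX hc (link_of_eq r1.symm)
        refine ⟨_, hc.1, fun y hy => ⟨p, ?_, ?_⟩⟩ <;> omega
      · exact absurd (eq_of_src_tgt hX (by omega) (by omega)) hrp
      · have hcr : c ≤ (X r).src := not_lt.1 fun h => r3 ⟨c, h, hc⟩
        refine ⟨c, hc.1, fun y hy => ?_⟩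
        by_cases e : y = (X p).src
        · exact ⟨p, e.symm, by omega⟩
        · exact hc.2 y (by omega)

/-- Every valid sequence is the one attached to an idempotent map: the map sends a position to the
position of the simple module it is linked to. -/
lemma exists_encodes_of_mem : ∃ (f : Fin n → Fin n) (v : Fin n → ℕ),
    (∀ p, f (f p) = f p) ∧ Encodes f v X := by
  choose c hc using exists_link hX
  choose f hf using fun p => (hc p).1
  have hcu : ∀ {p d}, Link X p d → c p = d := fun h => Link.unique hX (hc _) h
  have hidem : ∀ p, f (f p) = f p := by
    intro p
    have h1 : c (f p) = (X (f p)).src := hcu (link_of_eq ((hf p).1.trans (hf p).2.symm))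
    have h2 := hf p
    have h3 := hf (f p)
    unfold IsSimpleAt at h2 h3
    exact eq_of_src_tgt hX (by omega) (by omega)
  have hcases : ∀ p,
      ((X p).tgt = (X p).src ∧ label X p = (X p).src ∧ c p = (X p).src ∧ f p = p) ∨
      ((X p).tgt = (X p).src + 1 ∧ label X p = (X p).src ∧ (X p).src < c p ∧ f p < p) ∨
      ((X p).tgt = (X p).src + 1 ∧ label X p = (X p).src + 1 ∧ c p ≤ (X p).src ∧ p < f p) := by
    intro p
    rcases label_cases X p with ⟨p1, p2⟩ | ⟨p1, p2, d, p3, p4⟩ | ⟨p1, p2, p3⟩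
    · have h1 : c p = (X p).src := hcu (link_of_eq p1.symm)
      have h2 := hf p
      unfold IsSimpleAt at h2
      exact Or.inl ⟨p1, p2, h1, eq_of_src_tgt hX (by omega) (by omega)⟩
    · obtain rfl := hcu p4
      exact Or.inr (Or.inl ⟨p1, p2, p3, simple_lt_of_chain hX (hf p) (c p - (X p).src - 1)
        (x := (X p).src) ⟨rfl, p1⟩ (by omega) fun y h1 h2 => p4.2 y (by omega)⟩)
    · have h1 : c p ≤ (X p).src := not_lt.1 fun h => p3 ⟨_, h, hc p⟩
      exact Or.inr (Or.inr ⟨p1, p2, h1, lt_simple_of_chain hX (hf p) ((X p).src - c p)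
        (x := (X p).src) ⟨rfl, p1⟩ (by omega) fun y h1 h2 => (hc p).2 y (by omega)⟩)
  have hfc : ∀ p q, c p = c q → f p = f q := by
    intro p q h
    have h1 := hf p
    have h2 := hf q
    unfold IsSimpleAt at h1 h2
    exact eq_of_src_tgt hX (by omega) (by omega)
  -- Consecutive labels come from the same block, where the order is forced by the arrow between the
  -- two vertices, or from different blocks, which are ordered by their simple modules.
  have hstep : ∀ p q, label X q = label X p + 1 → Before f p q := by
    intro p q h
    have key : c p < c q ∨ (c q = c p ∧ q < p) := by
      rcases hcases q with ⟨q1, q2, q3, q4⟩ | ⟨q1, q2, q3, q4⟩ | ⟨q1, q2, q3, q4⟩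
      · rcases hcases p with ⟨p1, p2, p3, p4⟩ | ⟨p1, p2, p3, p4⟩ | ⟨p1, p2, p3, p4⟩
        · omega
        · refine Or.inr ⟨?_, simple_lt_arrow hX (c := (X p).src) ⟨by omega, by omega⟩ ⟨rfl, p1⟩⟩
          have hl : Link X p (X q).src := ⟨⟨q, rfl, q1⟩, fun y hy => ⟨p, by omega, by omega⟩⟩
          rw [q3, hcu hl]
        · omega
      · rcases hcases p with ⟨p1, p2, p3, p4⟩ | ⟨p1, p2, p3, p4⟩ | ⟨p1, p2, p3, p4⟩
        · omega
        · refine Or.inr ⟨?_, arrow_lt_arrow hX (c := (X p).src) ⟨by omega, by omega⟩ ⟨rfl, p1⟩⟩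
          refine (hcu ⟨(hc q).1, fun y hy => ?_⟩).symm
          by_cases e : y = (X p).src
          · exact ⟨p, e.symm, by omega⟩
          · exact (hc q).2 y (by omega)
        · omega
      · rcases hcases p with ⟨p1, p2, p3, p4⟩ | ⟨p1, p2, p3, p4⟩ | ⟨p1, p2, p3, p4⟩
        · refine Or.inr ⟨?_, arrow_lt_simple hX (c := (X q).src) ⟨rfl, q1⟩ ⟨by omega, by omega⟩⟩
          exact hcu ⟨(hc p).1, fun y hy => ⟨q, by omega, by omega⟩⟩
        · obtain rfl : p = q := eq_of_src_tgt hX (by omega) (by omega)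
          omega
        · refine Or.inr ⟨?_, arrow_lt_arrow hX (c := (X p).src) ⟨by omega, by omega⟩ ⟨rfl, p1⟩⟩
          refine hcu ⟨(hc p).1, fun y hy => ?_⟩
          by_cases e : y = (X q).src
          · exact ⟨q, e.symm, by omega⟩
          · exact (hc p).2 y (by omega)
    rcases key with hlt | ⟨he, hlt⟩
    · exact Or.inl (simple_lt_simple hX (hf p) (hf q) hlt)
    · exact Or.inr ⟨hfc p q he.symm, hlt⟩
  have hmono : ∀ d p q, label X q = label X p + d + 1 → Before f p q := by
    intro d
    induction d with
    | zero => exact hstep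
    | succ d ih =>
      intro p q h
      obtain ⟨r, hr⟩ := exists_eq_of_injective (label_lt X) (label_injective hX)
        (m := label X p + d + 1) (by have := label_lt X q; omega)
      have h1 := ih p r hr
      have h2 := hstep r q (by omega)
      unfold Before at *
      omega
  refine ⟨f, label X, hidem, ⟨label_lt X, fun p q => ⟨fun h => ?_, fun h => ?_⟩⟩, fun p => ?_,
    fun p => ?_⟩
  · exact hmono (label X q - label X p - 1) p q (by omega)
  · rcases lt_trichotomy (label X p) (label X q) with h1 | h1 | h1
    · exact h1
    · obtain rfl := label_injective hX h1
      unfold Before at h; omega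
    · have h2 := hmono (label X p - label X q - 1) q p (by omega)
      unfold Before at *; omega
  · have := hcases p
    split_ifs <;> omega
  · have := hcases p
    split_ifs <;> omega

end Valid

/-! ### Counting idempotent maps -/

/-- Idempotent self-maps of `Fin n` are in bijection with the valid sequences. -/
lemma encard_validSequences (n : ℕ) :
    (validSequences n).encard = Nat.card {f : Fin n → Fin n // f ∘ f = f} := by
  have hid : ∀ f : {f : Fin n → Fin n // f ∘ f = f}, ∀ p, f.1 (f.1 p) = f.1 p :=
    fun f p => congrFun f.2 p
  choose v X hX using fun f => exists_encodes (hid f)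
  have hinj : Function.Injective X := fun f g h =>
    Subtype.ext (Encodes.eq_map (hid f) (hid g) (hX f) (h ▸ hX g))
  have hrange : Set.range X = validSequences n := by
    ext Y
    constructor
    · rintro ⟨f, rfl⟩
      exact (hX f).mem_validSequences (hid f)
    · intro hY
      obtain ⟨f, w, hf, hfY⟩ := exists_encodes_of_mem hY
      exact ⟨⟨f, funext hf⟩, (hX _).eq hfY⟩
  rw [← hrange, ← Set.image_univ, hinj.encard_image, Set.encard_univ, ENat.card_eq_coe_natCard]

/-- An idempotent map is determined by its set of fixed points together with an arbitrary map from
the other points to the fixed points. -/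
lemma card_idempotents (n : ℕ) (hn : 1 ≤ n) :
    Nat.card {f : Fin n → Fin n // f ∘ f = f} =
      ∑ j ∈ Finset.Icc 1 n, n.choose j * j ^ (n - j) := by
  classical
  rw [Nat.card_eq_fintype_card, Fintype.card_subtype]
  have h1 : ∀ s : Finset (Fin n), (Finset.univ.filter fun f : Fin n → Fin n =>
      f ∘ f = f ∧ Finset.univ.filter (fun p => f p = p) = s).card = s.card ^ (n - s.card) := by
    intro s
    have : (Finset.univ.filter fun f : Fin n → Fin n =>
        f ∘ f = f ∧ Finset.univ.filter (fun p => f p = p) = s) =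
        Fintype.piFinset (fun p => if p ∈ s then {p} else s) := by
      ext f
      simp only [Finset.mem_filter, Finset.mem_univ, true_and, Fintype.mem_piFinset,
        funext_iff, Function.comp, Finset.ext_iff]
      constructor
      · rintro ⟨hf, hs⟩ p
        split_ifs with hp
        · exact Finset.mem_singleton.2 ((hs p).2 hp)
        · exact (hs _).1 (hf p)
      · intro h
        have h2 : ∀ p ∈ s, f p = p := fun p hp => by simpa [hp] using h p
        have h3 : ∀ p, f p ∈ s := fun p => by
          by_cases hp : p ∈ s
          · rwa [h2 p hp]
          · simpa [hp] using h p
        exact ⟨fun p => h2 _ (h3 p), fun p => ⟨fun e => e ▸ h3 p, h2 p⟩⟩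
    rw [this, Fintype.card_piFinset]
    simp only [apply_ite Finset.card, Finset.card_singleton]
    rw [Finset.prod_ite, Finset.prod_const_one, one_mul, Finset.prod_const]
    congr 1
    rw [Finset.filter_not, Finset.filter_univ_mem, ← Finset.compl_eq_univ_sdiff,
      Finset.card_compl, Fintype.card_fin]
  rw [Finset.card_eq_sum_card_fiberwise (t := Finset.univ)
    (f := fun f : Fin n → Fin n => Finset.univ.filter (fun p => f p = p)) (by simp)]
  simp only [Finset.filter_filter, h1]
  rw [← Finset.powerset_univ, Finset.sum_powerset_apply_card (fun j => j ^ (n - j)),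
    Finset.card_univ, Fintype.card_fin, Finset.range_eq_Ico, Finset.sum_eq_sum_Ico_succ_bot
    (Nat.succ_pos n), Nat.sub_zero, zero_pow (by omega), smul_zero, zero_add]
  rfl

end LinearNakayama

namespace LinearNakayama

universe u

/-! ### Generators of the algebra and their action on modules -/

section Generators

variable (k : Type u) [Field k] {n : ℕ}

/-- The trivial path at `i`, as an element of the algebra. -/
noncomputable def vtx (i : Fin n) : LinearNakayama k n :=
  RingQuot.mkAlgHom k (Rel k n) (e k i)

/-- The arrow `i ⟶ j`, as an element of the algebra. -/
noncomputable def arr (i j : Fin n) (h : (i : ℕ) + 1 = j) : LinearNakayama k n :=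
  RingQuot.mkAlgHom k (Rel k n) (a k i j h)

lemma vtx_mul_vtx (i j : Fin n) : vtx k i * vtx k j = if i = j then vtx k i else 0 := by
  unfold vtx
  split_ifs with h
  · subst h
    rw [← map_mul, RingQuot.mkAlgHom_rel k (Rel.idem i)]
  · rw [← map_mul, RingQuot.mkAlgHom_rel k (Rel.orth i j h), map_zero]

lemma sum_vtx : ∑ i : Fin n, vtx k i = 1 := by
  unfold vtx
  rw [← map_sum, RingQuot.mkAlgHom_rel k Rel.sum, map_one]

lemma arr_mul_vtx_self (i j : Fin n) (h : (i : ℕ) + 1 = j) :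
    arr k i j h * vtx k i = arr k i j h := by
  unfold arr vtx
  rw [← map_mul, RingQuot.mkAlgHom_rel k (Rel.source i j h)]

lemma vtx_mul_arr_self (i j : Fin n) (h : (i : ℕ) + 1 = j) :
    vtx k j * arr k i j h = arr k i j h := by
  unfold arr vtx
  rw [← map_mul, RingQuot.mkAlgHom_rel k (Rel.target i j h)]

lemma arr_mul_vtx (i j : Fin n) (h : (i : ℕ) + 1 = j) (l : Fin n) :
    arr k i j h * vtx k l = if l = i then arr k i j h else 0 := by
  split_ifs with hl
  · rw [hl, arr_mul_vtx_self]
  · rw [← arr_mul_vtx_self, mul_assoc, vtx_mul_vtx, if_neg (Ne.symm hl), mul_zero]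

lemma vtx_mul_arr (i j : Fin n) (h : (i : ℕ) + 1 = j) (l : Fin n) :
    vtx k l * arr k i j h = if l = j then arr k i j h else 0 := by
  split_ifs with hl
  · rw [hl, vtx_mul_arr_self]
  · rw [← vtx_mul_arr_self, ← mul_assoc, vtx_mul_vtx, if_neg hl, zero_mul]

lemma arr_mul_arr (i j i' j' : Fin n) (h : (i : ℕ) + 1 = j) (h' : (i' : ℕ) + 1 = j') :
    arr k i' j' h' * arr k i j h = 0 := by
  by_cases hij : i' = j
  · subst hij
    unfold arr
    rw [← map_mul, RingQuot.mkAlgHom_rel k (Rel.rad_sq _ _ _ h h'), map_zero]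
  · rw [← vtx_mul_arr_self k i j, ← mul_assoc, arr_mul_vtx, if_neg (Ne.symm hij), zero_mul]

variable {M : Type*} [AddCommGroup M] [Module (LinearNakayama k n) M]

lemma vtx_smul_vtx (i j : Fin n) (m : M) :
    vtx k i • vtx k j • m = if i = j then vtx k i • m else 0 := by
  rw [smul_smul, vtx_mul_vtx]; split_ifs <;> simp

lemma arr_smul_vtx (i j : Fin n) (h : (i : ℕ) + 1 = j) (l : Fin n) (m : M) :
    arr k i j h • vtx k l • m = if l = i then arr k i j h • m else 0 := by
  rw [smul_smul, arr_mul_vtx]; split_ifs <;> simp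

lemma vtx_smul_arr (i j : Fin n) (h : (i : ℕ) + 1 = j) (l : Fin n) (m : M) :
    vtx k l • arr k i j h • m = if l = j then arr k i j h • m else 0 := by
  rw [smul_smul, vtx_mul_arr]; split_ifs <;> simp

lemma arr_smul_arr (i j i' j' : Fin n) (h : (i : ℕ) + 1 = j) (h' : (i' : ℕ) + 1 = j') (m : M) :
    arr k i' j' h' • arr k i j h • m = 0 := by
  rw [smul_smul, arr_mul_arr, zero_smul]

/-- The scalar `c`, as an element of the algebra. -/
noncomputable abbrev sc (n : ℕ) (c : k) : LinearNakayama k n := algebraMap k (LinearNakayama k n) c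

lemma smul_sc (c : k) (r : LinearNakayama k n) (m : M) : r • sc k n c • m = sc k n c • r • m := by
  rw [smul_smul, smul_smul, Algebra.commutes]

variable {k}

variable {N : Type*} [AddCommGroup N] [Module (LinearNakayama k n) N]

/-- An additive map that commutes with scalars, vertices and arrows is linear. -/
noncomputable def mkLin (g : M →+ N) (hc : ∀ c (m : M), g (sc k n c • m) = sc k n c • g m)
    (he : ∀ (i : Fin n) (m : M), g (vtx k i • m) = vtx k i • g m)
    (ha : ∀ (i j : Fin n) h (m : M), g (arr k i j h • m) = arr k i j h • g m) :
    M →ₗ[LinearNakayama k n] N where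
  toFun := g
  map_add' := map_add g
  map_smul' r := by
    obtain ⟨r, rfl⟩ := RingQuot.mkAlgHom_surjective k (Rel k n) r
    induction r using FreeAlgebra.induction with
    | grade0 c => intro m; rw [AlgHom.commutes]; exact hc c m
    | grade1 x =>
      cases x with
      | vertex i => exact he i
      | arrow i j h => exact ha i j h
    | mul r s hr hs =>
      intro m
      simp only [RingHom.id_apply] at hr hs ⊢
      rw [map_mul, mul_smul, mul_smul, hr, hs]
    | add r s hr hs =>
      intro m
      simp only [RingHom.id_apply] at hr hs ⊢
      rw [map_add, add_smul, add_smul, map_add, hr, hs]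

@[simp] lemma mkLin_apply (g : M →+ N) (hc : ∀ c (m : M), g (sc k n c • m) = sc k n c • g m)
    (he : ∀ (i : Fin n) (m : M), g (vtx k i • m) = vtx k i • g m)
    (ha : ∀ (i j : Fin n) h (m : M), g (arr k i j h • m) = arr k i j h • g m) (m : M) :
    mkLin g hc he ha m = g m := rfl

end Generators

/-! ### The indecomposable modules -/


section Modules

variable (k : Type u) [Field k] {n : ℕ}

/-- The one-dimensional representation at the vertex `i`. -/
noncomputable def simpRep (i : Fin n) : LinearNakayama k n →ₐ[k] k :=
  RingQuot.liftAlgHom k ⟨FreeAlgebra.lift k fun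
    | .vertex v => if v = i then 1 else 0
    | .arrow _ _ _ => 0, by
    intro x y hxy
    induction hxy with
    | idem v => simp
    | orth v w h =>
      simp only [map_mul, FreeAlgebra.lift_ι_apply, map_zero]
      split_ifs with h1 h2
      · exact absurd (h1.trans h2.symm) h
      all_goals simp
    | sum => simp
    | source v w h => simp
    | target v w h => simp
    | rad_sq v w l h h' => simp⟩

/-- The two-dimensional representation supported at the arrow `i ⟶ j`. -/
noncomputable def projRep (i j : Fin n) (h : (i : ℕ) + 1 = j) :
    LinearNakayama k n →ₐ[k] Module.End k (k × k) :=
  RingQuot.liftAlgHom k ⟨FreeAlgebra.lift k fun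
    | .vertex v => LinearMap.prodMap (if v = i then LinearMap.id else 0)
        (if v = j then LinearMap.id else 0)
    | .arrow v _ _ => if v = i then LinearMap.inr k k k ∘ₗ LinearMap.fst k k k else 0, by
    have hij : i ≠ j := by rintro rfl; omega
    intro x y hxy
    induction hxy with
    | idem v =>
      refine LinearMap.ext fun m => ?_
      simp only [map_mul, FreeAlgebra.lift_ι_apply, Module.End.mul_apply]
      split_ifs <;> simp
    | orth v w h =>
      refine LinearMap.ext fun m => ?_
      simp only [map_mul, FreeAlgebra.lift_ι_apply, Module.End.mul_apply, map_zero]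
      split_ifs <;> first | (exfalso; omega) | simp
    | sum =>
      refine LinearMap.ext fun m => ?_
      simp only [map_sum, FreeAlgebra.lift_ι_apply, LinearMap.sum_apply, map_one,
        Module.End.one_apply]
      refine Prod.ext ?_ ?_
      · rw [Prod.fst_sum, Finset.sum_eq_single i] <;> simp +contextual
      · rw [Prod.snd_sum, Finset.sum_eq_single j] <;> simp +contextual
    | source v w h =>
      refine LinearMap.ext fun m => ?_
      simp only [map_mul, FreeAlgebra.lift_ι_apply, Module.End.mul_apply]
      split_ifs <;> simp
    | target v w h' =>
      refine LinearMap.ext fun m => ?_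
      simp only [map_mul, FreeAlgebra.lift_ι_apply, Module.End.mul_apply]
      split_ifs <;> first | (exfalso; omega) | simp
    | rad_sq v w l h1 h2 =>
      refine LinearMap.ext fun m => ?_
      simp only [map_mul, FreeAlgebra.lift_ι_apply, Module.End.mul_apply, map_zero]
      split_ifs <;> first | (exfalso; omega) | simp⟩

/-- The underlying space of the simple module at the vertex `i`. -/
def Simp (_ : Fin n) : Type u := k

/-- The underlying space of the indecomposable module with top `i` and socle `j`; the first
coordinate is the part at `i`, the second one the part at `j`. -/
def Proj (i j : Fin n) (_ : (i : ℕ) + 1 = j) : Type u := k × k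

noncomputable instance (i : Fin n) : AddCommGroup (Simp k i) := inferInstanceAs (AddCommGroup k)

noncomputable instance (i : Fin n) : Module (LinearNakayama k n) (Simp k i) :=
  Module.compHom k (simpRep k i).toRingHom

noncomputable instance (i j : Fin n) (h : (i : ℕ) + 1 = j) : AddCommGroup (Proj k i j h) :=
  inferInstanceAs (AddCommGroup (k × k))

noncomputable instance (i j : Fin n) (h : (i : ℕ) + 1 = j) :
    Module (LinearNakayama k n) (Proj k i j h) :=
  Module.compHom (k × k) (projRep k i j h).toRingHom

variable {k}

/-- The element of the simple module with coordinate `u`. -/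
def Simp.mk (i : Fin n) (u : k) : Simp k i := u

/-- The coordinate of an element of the simple module. -/
def Simp.val {i : Fin n} (x : Simp k i) : k := x

/-- The element of `Proj k i j h` with coordinates `u` and `w`. -/
def Proj.mk {i j : Fin n} (h : (i : ℕ) + 1 = j) (u w : k) : Proj k i j h := (u, w)

/-- The coordinate at the top of an element of `Proj k i j h`. -/
def Proj.top {i j : Fin n} {h : (i : ℕ) + 1 = j} (x : Proj k i j h) : k := Prod.fst x

/-- The coordinate at the socle of an element of `Proj k i j h`. -/
def Proj.soc {i j : Fin n} {h : (i : ℕ) + 1 = j} (x : Proj k i j h) : k := Prod.snd x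

namespace Simp

variable {i : Fin n}

omit [Field k] in
lemma ext {x y : Simp k i} (h : x.val = y.val) : x = y := h

omit [Field k] in
@[simp] lemma val_mk (u : k) : (mk i u).val = u := rfl

@[simp] lemma val_add (x y : Simp k i) : (x + y).val = x.val + y.val := rfl
@[simp] lemma val_zero : (0 : Simp k i).val = 0 := rfl

lemma val_smul (r : LinearNakayama k n) (x : Simp k i) :
    (r • x).val = simpRep k i r * x.val := rfl

@[simp] lemma val_sc_smul (c : k) (x : Simp k i) : (sc k n c • x).val = c * x.val := by
  rw [val_smul, AlgHom.commutes]; rfl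

@[simp] lemma val_vtx_smul (v : Fin n) (x : Simp k i) :
    (vtx k v • x).val = if v = i then x.val else 0 := by
  rw [val_smul, vtx, simpRep, RingQuot.liftAlgHom_mkAlgHom_apply, FreeAlgebra.lift_ι_apply]
  dsimp only
  split_ifs <;> simp

@[simp] lemma val_arr_smul (v w : Fin n) (h : (v : ℕ) + 1 = w) (x : Simp k i) :
    (arr k v w h • x).val = 0 := by
  rw [val_smul, arr, simpRep, RingQuot.liftAlgHom_mkAlgHom_apply, FreeAlgebra.lift_ι_apply,
    zero_mul]

lemma mk_eq_smul (x : Simp k i) : x = sc k n x.val • mk i 1 := ext (by simp)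

variable {M : Type*} [AddCommGroup M] [Module (LinearNakayama k n) M]

lemma hom_ext {f g : Simp k i →ₗ[LinearNakayama k n] M} (h : f (mk i 1) = g (mk i 1)) : f = g := by
  ext x
  rw [mk_eq_smul x, map_smul, map_smul, h]

/-- The homomorphism from the simple module at `i` given by an element at the vertex `i` that is
annihilated by the arrow starting at `i`. -/
noncomputable def hom (y : M) (hy : vtx k i • y = y) (ha : ∀ j h, arr k i j h • y = 0) :
    Simp k i →ₗ[LinearNakayama k n] M :=
  mkLin
    { toFun := fun x => sc k n x.val • y
      map_zero' := by simp
      map_add' := fun x z => by simp [add_smul] }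
    (fun c m => by simp [mul_smul])
    (fun v m => by
      simp only [AddMonoidHom.coe_mk, ZeroHom.coe_mk, val_vtx_smul, smul_sc]
      rw [← hy, vtx_smul_vtx]
      split_ifs with h
      · rw [h]
      · simp)
    (fun v w h m => by
      simp only [AddMonoidHom.coe_mk, ZeroHom.coe_mk, val_arr_smul, smul_sc, map_zero, zero_smul]
      rw [← hy, arr_smul_vtx]
      split_ifs with h'
      · subst h'; rw [ha, smul_zero]
      · simp)

@[simp] lemma hom_apply (y : M) (hy : vtx k i • y = y) (ha : ∀ j h, arr k i j h • y = 0)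
    (x : Simp k i) : hom y hy ha x = sc k n x.val • y := rfl

lemma hom_top (f : Simp k i →ₗ[LinearNakayama k n] M) : vtx k i • f (mk i 1) = f (mk i 1) := by
  rw [← map_smul]; congr 1; exact ext (by simp)

lemma hom_arr (f : Simp k i →ₗ[LinearNakayama k n] M) (x : Simp k i) (v w : Fin n)
    (h : (v : ℕ) + 1 = w) : arr k v w h • f x = 0 := by
  rw [← map_smul, ext (x := arr k v w h • x) (y := 0) (by simp), map_zero]

end Simp

namespace Proj

variable {i j : Fin n} {h : (i : ℕ) + 1 = j}

omit [Field k] in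
lemma ext {x y : Proj k i j h} (h₁ : x.top = y.top) (h₂ : x.soc = y.soc) : x = y := Prod.ext h₁ h₂

omit [Field k] in
@[simp] lemma top_mk (u w : k) : (mk h u w).top = u := rfl

omit [Field k] in
@[simp] lemma soc_mk (u w : k) : (mk h u w).soc = w := rfl

@[simp] lemma top_add (x y : Proj k i j h) : (x + y).top = x.top + y.top := rfl
@[simp] lemma soc_add (x y : Proj k i j h) : (x + y).soc = x.soc + y.soc := rfl
@[simp] lemma top_zero : (0 : Proj k i j h).top = 0 := rfl
@[simp] lemma soc_zero : (0 : Proj k i j h).soc = 0 := rfl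

lemma smul_def (r : LinearNakayama k n) (x : Proj k i j h) :
    r • x = (projRep k i j h r : k × k →ₗ[k] k × k) x := rfl

lemma sc_smul (c : k) (x : Proj k i j h) : sc k n c • x = mk h (c * x.top) (c * x.soc) := by
  rw [smul_def, AlgHom.commutes]; rfl

lemma vtx_smul (v : Fin n) (x : Proj k i j h) :
    vtx k v • x = mk h (if v = i then x.top else 0) (if v = j then x.soc else 0) := by
  rw [smul_def, vtx, projRep, RingQuot.liftAlgHom_mkAlgHom_apply, FreeAlgebra.lift_ι_apply]
  dsimp only
  refine ext ?_ ?_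
  · split_ifs <;> rfl
  · split_ifs <;> rfl

lemma arr_smul (v w : Fin n) (h' : (v : ℕ) + 1 = w) (x : Proj k i j h) :
    arr k v w h' • x = mk h 0 (if v = i then x.top else 0) := by
  rw [smul_def, arr, projRep, RingQuot.liftAlgHom_mkAlgHom_apply, FreeAlgebra.lift_ι_apply]
  dsimp only
  refine ext ?_ ?_
  · split_ifs <;> rfl
  · split_ifs <;> rfl

lemma mk_eq_smul (x : Proj k i j h) :
    x = sc k n x.top • mk h 1 0 + sc k n x.soc • arr k i j h • mk h 1 0 :=
  ext (by simp [sc_smul, arr_smul]) (by simp [sc_smul, arr_smul])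

variable {M : Type*} [AddCommGroup M] [Module (LinearNakayama k n) M]

lemma hom_ext {f g : Proj k i j h →ₗ[LinearNakayama k n] M} (e : f (mk h 1 0) = g (mk h 1 0)) :
    f = g := by
  ext x
  rw [mk_eq_smul x]
  simp only [map_add, map_smul, e]

lemma src_ne_tgt (h : (i : ℕ) + 1 = j) : i ≠ j := by rintro rfl; omega

/-- The homomorphism from `Proj k i j h` given by an element at the vertex `i`. -/
noncomputable def hom (y : M) (hy : vtx k i • y = y) : Proj k i j h →ₗ[LinearNakayama k n] M :=
  mkLin
    { toFun := fun x => sc k n x.top • y + sc k n x.soc • arr k i j h • y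
      map_zero' := by simp
      map_add' := fun x z => by simp only [top_add, soc_add, map_add, add_smul]; abel }
    (fun c m => by simp [sc_smul, mul_smul])
    (fun v m => by
      have hij := src_ne_tgt h
      simp only [AddMonoidHom.coe_mk, ZeroHom.coe_mk, vtx_smul, top_mk, soc_mk, smul_add, smul_sc,
        vtx_smul_arr]
      conv_rhs => rw [← hy, vtx_smul_vtx]
      split_ifs with h1 h2 h2
      · exact absurd (h1.symm.trans h2) hij
      · rw [h1, hy]; simp
      · rw [hy]; simp
      · simp)
    (fun v w h' m => by
      simp only [AddMonoidHom.coe_mk, ZeroHom.coe_mk, arr_smul, top_mk, soc_mk, smul_add, smul_sc,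
        arr_smul_arr, smul_zero, map_zero, zero_smul, zero_add, add_zero]
      conv_rhs => rw [← hy, arr_smul_vtx]
      split_ifs with h1 h2 h2
      · subst h1
        obtain rfl : j = w := Fin.ext (by omega)
        rfl
      · exact absurd h1.symm h2
      · exact absurd h2.symm h1
      · simp)

@[simp] lemma hom_apply (y : M) (hy : vtx k i • y = y) (x : Proj k i j h) :
    hom y hy x = sc k n x.top • y + sc k n x.soc • arr k i j h • y := rfl

lemma hom_top (f : Proj k i j h →ₗ[LinearNakayama k n] M) :
    vtx k i • f (mk h 1 0) = f (mk h 1 0) := by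
  have hij := src_ne_tgt h
  rw [← map_smul]; congr 1; exact ext (by simp [vtx_smul]) (by simp [vtx_smul])

end Proj

end Modules

end LinearNakayama

open CategoryTheory

/-! ### Dimension shifting -/

section Shift

universe v' w' u'

open Abelian

variable {C : Type u'} [Category.{v'} C] [Abelian C] [HasExt.{w'} C]

lemma subsingleton_ext_zero_iff (X Y : C) : Subsingleton (Ext X Y 0) ↔ Subsingleton (X ⟶ Y) :=
  Ext.homEquiv₀.subsingleton_congr

lemma subsingleton_ext_of_iso {X X' Y Y' : C} (e : X ≅ X') (e' : Y ≅ Y') (s : ℕ)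
    (h : Subsingleton (Ext X Y s)) : Subsingleton (Ext X' Y' s) := by
  have h1 : Subsingleton (Ext X' Y s) := by
    refine subsingleton_of_forall_eq 0 fun x => ?_
    rw [← Ext.mk₀_id_comp x, ← e.inv_hom_id, ← Ext.mk₀_comp_mk₀_assoc,
      Subsingleton.elim ((Ext.mk₀ e.hom).comp x (zero_add s)) 0, Ext.comp_zero]
  refine subsingleton_of_forall_eq 0 fun x => ?_
  rw [← Ext.comp_mk₀_id x, ← e'.inv_hom_id, ← Ext.mk₀_comp_mk₀,
    ← Ext.comp_assoc_of_third_deg_zero, Subsingleton.elim (x.comp (Ext.mk₀ e'.inv) (add_zero s)) 0,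
    Ext.zero_comp]

variable {S : ShortComplex C} (hS : S.ShortExact) (Y : C)
include hS

lemma subsingleton_ext_X₃_succ (s : ℕ) (h₁ : Subsingleton (Ext S.X₁ Y s))
    (h₂ : Subsingleton (Ext S.X₂ Y (s + 1))) : Subsingleton (Ext S.X₃ Y (s + 1)) := by
  refine subsingleton_of_forall_eq 0 fun x => ?_
  obtain ⟨y, rfl⟩ := Ext.contravariant_sequence_exact₃ hS Y x (Subsingleton.elim _ _)
    (n₀ := s) (add_comm 1 s)
  rw [Subsingleton.elim y 0, Ext.comp_zero]

/-- `Ext¹(S.X₃, Y)` vanishes if all morphisms `S.X₁ ⟶ Y` extend to `S.X₂`. -/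
lemma subsingleton_ext_X₃_one (h₁ : ∀ f : S.X₁ ⟶ Y, ∃ g : S.X₂ ⟶ Y, S.f ≫ g = f)
    (h₂ : Subsingleton (Ext S.X₂ Y 1)) : Subsingleton (Ext S.X₃ Y 1) := by
  refine subsingleton_of_forall_eq 0 fun x => ?_
  obtain ⟨y, rfl⟩ := Ext.contravariant_sequence_exact₃ hS Y x (Subsingleton.elim _ _)
    (n₀ := 0) rfl
  obtain ⟨f, rfl⟩ := Ext.homEquiv₀.symm.surjective y
  obtain ⟨g, rfl⟩ := h₁ f
  change hS.extClass.comp (Ext.mk₀ (S.f ≫ g)) _ = 0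
  rw [← Ext.mk₀_comp_mk₀, ← Ext.comp_assoc_of_third_deg_zero, hS.extClass_comp, Ext.zero_comp]

lemma subsingleton_ext_X₁ (s : ℕ) (h₂ : Subsingleton (Ext S.X₂ Y s))
    (h₃ : Subsingleton (Ext S.X₃ Y (s + 1))) : Subsingleton (Ext S.X₁ Y s) := by
  refine subsingleton_of_forall_eq 0 fun x => ?_
  obtain ⟨y, rfl⟩ := Ext.contravariant_sequence_exact₁ hS Y x (add_comm 1 s) (Subsingleton.elim _ _)
  rw [Subsingleton.elim y 0, Ext.comp_zero]

end Shift

namespace LinearNakayama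

universe u

/-! ### Morphisms and extensions between the indecomposable modules -/

section Homs

open Abelian

variable (k : Type u) [Field k] {n : ℕ}

/-- The simple module at `i`. -/
noncomputable abbrev simp (i : Fin n) : ModuleCat.{u} (LinearNakayama k n) :=
  ModuleCat.of _ (Simp k i)

/-- The indecomposable module with top `i` and socle `j`. -/
noncomputable abbrev proj (i j : Fin n) (h : (i : ℕ) + 1 = j) :
    ModuleCat.{u} (LinearNakayama k n) :=
  ModuleCat.of _ (Proj k i j h)

/-- The indecomposable module with a given label. -/
noncomputable def indec : Gen n → ModuleCat.{u} (LinearNakayama k n)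
  | .vertex i => simp k i
  | .arrow i j h => proj k i j h

/-- A morphism from `P_i` is given by an arbitrary element at the vertex `i`, and such elements lift
along surjections. -/
instance (i j : Fin n) (h : (i : ℕ) + 1 = j) : Projective (proj k i j h) := by
  refine (IsProjective.iff_projective _).1 (Module.Projective.of_lifting_property'' fun f hf => ?_)
  obtain ⟨z, hz⟩ := hf (Proj.mk h 1 0)
  refine ⟨Proj.hom (vtx k i • z) ((vtx_smul_vtx k i i z).trans (if_pos rfl)), Proj.hom_ext ?_⟩
  have : f (vtx k i • z) = Proj.mk h 1 0 := by
    rw [map_smul, hz]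
    exact Proj.hom_top (LinearMap.id : Proj k i j h →ₗ[LinearNakayama k n] _)
  simp [this]

/-- No arrow starts at the last vertex, so the simple module there is projective. -/
lemma projective_simp_last (i : Fin n) (hi : (i : ℕ) + 1 = n) : Projective (simp k i) := by
  refine (IsProjective.iff_projective _).1 (Module.Projective.of_lifting_property'' fun f hf => ?_)
  obtain ⟨z, hz⟩ := hf (Simp.mk i 1)
  refine ⟨Simp.hom (vtx k i • z) ((vtx_smul_vtx k i i z).trans (if_pos rfl))
    (fun j h => by have := j.2; omega), Simp.hom_ext ?_⟩
  have : f (vtx k i • z) = Simp.mk i 1 := by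
    rw [map_smul, hz]
    exact Simp.hom_top (LinearMap.id : Simp k i →ₗ[LinearNakayama k n] _)
  simp [this]

variable {k}

lemma subsingleton_hom {M N : Type u} [AddCommGroup M] [Module (LinearNakayama k n) M]
    [AddCommGroup N] [Module (LinearNakayama k n) N] (h : ∀ f : M →ₗ[LinearNakayama k n] N, f = 0) :
    Subsingleton (ModuleCat.of (LinearNakayama k n) M ⟶ ModuleCat.of (LinearNakayama k n) N) :=
  subsingleton_of_forall_eq 0 fun f => ModuleCat.hom_ext (h f.hom)

lemma not_subsingleton_hom {M N : Type u} [AddCommGroup M] [Module (LinearNakayama k n) M]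
    [AddCommGroup N] [Module (LinearNakayama k n) N] (f : M →ₗ[LinearNakayama k n] N) (x : M)
    (h : f x ≠ 0) :
    ¬ Subsingleton (ModuleCat.of (LinearNakayama k n) M ⟶ ModuleCat.of (LinearNakayama k n) N) := by
  intro hs
  have : ModuleCat.ofHom f = 0 := Subsingleton.elim _ _
  exact h (by simpa using congrArg (fun g => g.hom x) this)

lemma Simp.mk_ne_zero (i : Fin n) : (Simp.mk i 1 : Simp k i) ≠ 0 := fun h =>
  one_ne_zero (α := k) (congrArg Simp.val h)

lemma Proj.mk_ne_zero {i j : Fin n} (h : (i : ℕ) + 1 = j) : (Proj.mk h 1 0 : Proj k i j h) ≠ 0 :=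
  fun e => one_ne_zero (α := k) (congrArg Proj.top e)

lemma subsingleton_hom_simp_simp {i j : Fin n} (h : i ≠ j) :
    Subsingleton (simp k i ⟶ simp k j) :=
  subsingleton_hom fun f => Simp.hom_ext <| Simp.ext <| by
    have := congrArg Simp.val (Simp.hom_top f)
    rw [Simp.val_vtx_smul, if_neg h] at this
    exact this.symm

lemma subsingleton_hom_proj_simp {i i' j : Fin n} (hi : (i : ℕ) + 1 = i') (h : i ≠ j) :
    Subsingleton (proj k i i' hi ⟶ simp k j) :=
  subsingleton_hom fun f => Proj.hom_ext <| Simp.ext <| by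
    have := congrArg Simp.val (Proj.hom_top f)
    rw [Simp.val_vtx_smul, if_neg h] at this
    exact this.symm

lemma top_eq_zero_of_hom {i j j' : Fin n} (hj : (j : ℕ) + 1 = j')
    (f : Simp k i →ₗ[LinearNakayama k n] Proj k j j' hj) : (f (Simp.mk i 1)).top = 0 := by
  have := congrArg Proj.soc (Simp.hom_arr f (Simp.mk i 1) j j' hj)
  simpa [Proj.arr_smul] using this

lemma subsingleton_hom_simp_proj {i j j' : Fin n} (hj : (j : ℕ) + 1 = j') (h : i ≠ j') :
    Subsingleton (simp k i ⟶ proj k j j' hj) :=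
  subsingleton_hom fun f => Simp.hom_ext <| Proj.ext (top_eq_zero_of_hom hj f) <| by
    have := congrArg Proj.soc (Simp.hom_top f)
    rw [Proj.vtx_smul, Proj.soc_mk, if_neg h] at this
    exact this.symm

lemma subsingleton_hom_proj_proj {i i' j j' : Fin n} (hi : (i : ℕ) + 1 = i')
    (hj : (j : ℕ) + 1 = j') (h : i ≠ j) (h' : i ≠ j') :
    Subsingleton (proj k i i' hi ⟶ proj k j j' hj) :=
  subsingleton_hom fun f => Proj.hom_ext <| Proj.ext
    (by
      have := congrArg Proj.top (Proj.hom_top f)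
      rw [Proj.vtx_smul, Proj.top_mk, if_neg h] at this
      exact this.symm)
    (by
      have := congrArg Proj.soc (Proj.hom_top f)
      rw [Proj.vtx_smul, Proj.soc_mk, if_neg h'] at this
      exact this.symm)

/-- The inclusion of the socle. -/
noncomputable def socle {i j : Fin n} (h : (i : ℕ) + 1 = j) :
    Simp k j →ₗ[LinearNakayama k n] Proj k i j h :=
  Simp.hom (Proj.mk h 0 1) (by simp [Proj.vtx_smul]) (fun l hl => by
    rw [Proj.arr_smul, if_neg (Proj.src_ne_tgt h).symm]; rfl)

/-- The projection to the top. -/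
noncomputable def top {i j : Fin n} (h : (i : ℕ) + 1 = j) :
    Proj k i j h →ₗ[LinearNakayama k n] Simp k i :=
  Proj.hom (Simp.mk i 1) (Simp.ext (by simp))

lemma socle_apply {i j : Fin n} (h : (i : ℕ) + 1 = j) (x : Simp k j) :
    socle h x = Proj.mk h 0 x.val := by
  simp [socle, Proj.sc_smul]

lemma top_apply {i j : Fin n} (h : (i : ℕ) + 1 = j) (x : Proj k i j h) :
    top h x = Simp.mk i x.top :=
  Simp.ext (by simp [top])

/-- A morphism from the socle of `P_i` to `P_i` is the restriction of a scalar. -/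
lemma exists_comp_socle_eq {i j : Fin n} (h : (i : ℕ) + 1 = j)
    (f : Simp k j →ₗ[LinearNakayama k n] Proj k i j h) :
    ∃ g : Proj k i j h →ₗ[LinearNakayama k n] Proj k i j h, g ∘ₗ socle h = f := by
  refine ⟨Proj.hom (Proj.mk h (f (Simp.mk j 1)).soc 0) (Proj.ext (by simp [Proj.vtx_smul])
    (by simp [Proj.vtx_smul])), Simp.hom_ext ?_⟩
  rw [LinearMap.comp_apply, socle_apply]
  refine Proj.ext ?_ ?_
  · rw [top_eq_zero_of_hom h f]
    simp [Proj.arr_smul]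
  · simp [Proj.arr_smul]

variable (k) in
/-- The sequence `0 ⟶ S_j ⟶ P_i ⟶ S_i ⟶ 0` for an arrow `i ⟶ j`. -/
noncomputable abbrev socleTop {i j : Fin n} (h : (i : ℕ) + 1 = j) :
    ShortComplex (ModuleCat.{u} (LinearNakayama k n)) where
  X₁ := simp k j
  X₂ := proj k i j h
  X₃ := simp k i
  f := ModuleCat.ofHom (socle h)
  g := ModuleCat.ofHom (top h)
  zero := by
    ext x
    simp only [ModuleCat.hom_comp, ModuleCat.hom_ofHom, LinearMap.comp_apply, socle_apply,
      top_apply, Proj.top_mk]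
    rfl

lemma socleTop_shortExact {i j : Fin n} (h : (i : ℕ) + 1 = j) : (socleTop k h).ShortExact := by
  refine ShortComplex.ShortExact.mk' ?_ ?_ ?_
  · rw [ShortComplex.moduleCat_exact_iff]
    intro x hx
    refine ⟨Simp.mk j (Proj.soc (k := k) (h := h) x), ?_⟩
    have h1 : top h x = 0 := hx
    rw [top_apply] at h1
    have h2 : Proj.top (k := k) (h := h) x = 0 := congrArg Simp.val h1
    exact (socle_apply h _).trans (Proj.ext h2.symm rfl)
  · rw [ModuleCat.mono_iff_injective]
    intro (x : Simp k j) (y : Simp k j) hxy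
    have h1 : socle h x = socle h y := hxy
    rw [socle_apply, socle_apply] at h1
    exact Simp.ext (congrArg Proj.soc h1)
  · rw [ModuleCat.epi_iff_surjective]
    intro (x : Simp k i)
    exact ⟨Proj.mk h x.val 0, top_apply h _⟩

/-- `Ext^s(S_i, S_j) = 0` unless `j = i + s`. -/
lemma subsingleton_ext_simp_simp (s : ℕ) : ∀ {i j : Fin n}, (i : ℕ) + s ≠ j →
    Subsingleton (Ext (simp k i) (simp k j) s) := by
  induction s with
  | zero =>
    intro i j h
    rw [subsingleton_ext_zero_iff]
    exact subsingleton_hom_simp_simp (by rintro rfl; exact h rfl)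
  | succ s ih =>
    intro i j h
    by_cases hi : (i : ℕ) + 1 = n
    · have := projective_simp_last k i hi
      exact Ext.subsingleton_of_projective _ _ _
    · obtain ⟨m, hi'⟩ : ∃ m : Fin n, (i : ℕ) + 1 = m := ⟨⟨i + 1, by omega⟩, rfl⟩
      exact subsingleton_ext_X₃_succ (socleTop_shortExact (k := k) hi') _ s
        (ih (by omega)) (Ext.subsingleton_of_projective _ _ _)

/-- `Ext^s(S_i, S_{i + s}) ≠ 0`. -/
lemma not_subsingleton_ext_simp_simp (s : ℕ) : ∀ {i j : Fin n}, (i : ℕ) + s = j →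
    ¬ Subsingleton (Ext (simp k i) (simp k j) s) := by
  induction s with
  | zero =>
    intro i j h
    obtain rfl : i = j := Fin.ext h
    rw [subsingleton_ext_zero_iff]
    exact not_subsingleton_hom LinearMap.id (Simp.mk i 1) (Simp.mk_ne_zero i)
  | succ s ih =>
    intro i j h hs
    obtain ⟨m, hi'⟩ : ∃ m : Fin n, (i : ℕ) + 1 = m := ⟨⟨i + 1, by omega⟩, rfl⟩
    refine ih (i := m) (j := j) (by omega)
      (subsingleton_ext_X₁ (socleTop_shortExact (k := k) hi') _ s ?_ hs)
    cases s with
    | zero =>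
      exact (subsingleton_ext_zero_iff _ _).2
        (subsingleton_hom_proj_simp hi' (by rintro rfl; omega))
    | succ s => exact Ext.subsingleton_of_projective _ _ _

/-- `Ext^s(S_i, P_j) = 0` for `s ≥ 1`. -/
lemma subsingleton_ext_simp_proj (s : ℕ) : ∀ {i j j' : Fin n} (hj : (j : ℕ) + 1 = j'),
    Subsingleton (Ext (simp k i) (proj k j j' hj) (s + 1)) := by
  induction s with
  | zero =>
    intro i j j' hj
    by_cases hi : (i : ℕ) + 1 = n
    · have := projective_simp_last k i hi
      exact Ext.subsingleton_of_projective _ _ _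
    obtain ⟨m, hi'⟩ : ∃ m : Fin n, (i : ℕ) + 1 = m := ⟨⟨i + 1, by omega⟩, rfl⟩
    refine subsingleton_ext_X₃_one (socleTop_shortExact (k := k) hi') _ (fun f => ?_)
      (Ext.subsingleton_of_projective _ _ _)
    by_cases hij : i = j
    · subst hij
      obtain rfl : j' = m := Fin.ext (by omega)
      obtain ⟨g, hg⟩ := exists_comp_socle_eq hj (ModuleCat.Hom.hom f)
      exact ⟨ModuleCat.ofHom g, ModuleCat.hom_ext hg⟩
    · have := subsingleton_hom_simp_proj (k := k) (i := m) hj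
        (by rintro rfl; exact hij (Fin.ext (by omega)))
      exact ⟨0, Subsingleton.elim _ _⟩
  | succ s ih =>
    intro i j j' hj
    by_cases hi : (i : ℕ) + 1 = n
    · have := projective_simp_last k i hi
      exact Ext.subsingleton_of_projective _ _ _
    obtain ⟨m, hi'⟩ : ∃ m : Fin n, (i : ℕ) + 1 = m := ⟨⟨i + 1, by omega⟩, rfl⟩
    exact subsingleton_ext_X₃_succ (socleTop_shortExact (k := k) hi') _ (s + 1) (ih hj)
      (Ext.subsingleton_of_projective _ _ _)

/-- The label relation `NonOrth` computes the non-vanishing of some `Ext^s`, `s ≥ 0`. -/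
lemma nonOrth_iff_ext (Y X : Gen n) :
    NonOrth Y X ↔ ∃ s, ¬ Subsingleton (Ext (indec k Y) (indec k X) s) := by
  cases Y with
  | vertex i =>
    cases X with
    | vertex j =>
      constructor
      · intro h
        have h' : (i : ℕ) ≤ j := h
        exact ⟨j - i, not_subsingleton_ext_simp_simp _ (by omega)⟩
      · rintro ⟨s, hs⟩
        by_contra hij
        have hij' : ¬ (i : ℕ) ≤ j := hij
        exact hs (subsingleton_ext_simp_simp s (by omega))
    | arrow j j' hj =>
      constructor
      · rintro (rfl : i = j')
        refine ⟨0, fun h => ?_⟩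
        rw [subsingleton_ext_zero_iff] at h
        refine not_subsingleton_hom (socle hj) (Simp.mk _ 1) (fun h => ?_) h
        rw [socle_apply] at h
        exact one_ne_zero (α := k) (congrArg Proj.soc h)
      · rintro ⟨s, hs⟩
        by_contra hij
        cases s with
        | zero => exact hs ((subsingleton_ext_zero_iff _ _).2 (subsingleton_hom_simp_proj hj hij))
        | succ s => exact hs (subsingleton_ext_simp_proj s hj)
  | arrow i i' hi =>
    cases X with
    | vertex j =>
      constructor
      · rintro (rfl : i = j)
        refine ⟨0, fun h => ?_⟩
        rw [subsingleton_ext_zero_iff] at h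
        refine not_subsingleton_hom (top hi) (Proj.mk hi 1 0) (fun h => ?_) h
        rw [top_apply] at h
        exact one_ne_zero (α := k) (congrArg Simp.val h)
      · rintro ⟨s, hs⟩
        by_contra hij
        cases s with
        | zero => exact hs ((subsingleton_ext_zero_iff _ _).2 (subsingleton_hom_proj_simp hi hij))
        | succ s => exact hs (Ext.subsingleton_of_projective (proj k i i' hi) _ s)
    | arrow j j' hj =>
      constructor
      · rintro (rfl | rfl)
        · obtain rfl : i' = j' := Fin.ext (by omega)
          refine ⟨0, fun h => ?_⟩
          rw [subsingleton_ext_zero_iff] at h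
          exact not_subsingleton_hom LinearMap.id (Proj.mk hi 1 0) (Proj.mk_ne_zero hi) h
        · refine ⟨0, fun h => ?_⟩
          rw [subsingleton_ext_zero_iff] at h
          refine not_subsingleton_hom (socle hj ∘ₗ top hi) (Proj.mk hi 1 0) (fun h => ?_) h
          rw [LinearMap.comp_apply, socle_apply, top_apply] at h
          exact one_ne_zero (α := k) (congrArg Proj.soc h)
      · rintro ⟨s, hs⟩
        by_contra hij
        cases s with
        | zero =>
          exact hs ((subsingleton_ext_zero_iff _ _).2 (subsingleton_hom_proj_proj hi hj
            (fun e => hij (Or.inl e)) (fun e => hij (Or.inr e))))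
        | succ s => exact hs (Ext.subsingleton_of_projective (proj k i i' hi) _ s)

/-- The modules `indec k X` are pairwise non-isomorphic. -/
lemma eq_of_iso {X Y : Gen n} (h : indec k X ≅ indec k Y) : X = Y := by
  have hr : ∀ Z : Gen n, NonOrth Z Z := fun Z => by
    cases Z with
    | vertex i => exact le_rfl
    | arrow i j h => exact Or.inl rfl
  have h1 : NonOrth X Y := by
    obtain ⟨s, hs⟩ := (nonOrth_iff_ext (k := k) X X).1 (hr X)
    exact (nonOrth_iff_ext (k := k) X Y).2
      ⟨s, fun h' => hs (subsingleton_ext_of_iso (Iso.refl _) h.symm s h')⟩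
  have h2 : NonOrth Y X := by
    obtain ⟨s, hs⟩ := (nonOrth_iff_ext (k := k) X X).1 (hr X)
    exact (nonOrth_iff_ext (k := k) Y X).2
      ⟨s, fun h' => hs (subsingleton_ext_of_iso h.symm (Iso.refl _) s h')⟩
  rw [nonOrth_iff] at h1 h2
  have h3 := X.tgt_eq
  have h4 := Y.tgt_eq
  exact Gen.ext_src_tgt (by omega) (by omega)

lemma subsingleton_ext_self (X : Gen n) (s : ℕ) (hs : 1 ≤ s) :
    Subsingleton (Ext (indec k X) (indec k X) s) := by
  obtain ⟨s, rfl⟩ := Nat.exists_eq_add_of_le' hs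
  cases X with
  | vertex i => exact subsingleton_ext_simp_simp _ (by omega)
  | arrow i j h => exact Ext.subsingleton_of_projective (proj k i j h) _ s

end Homs

end LinearNakayama

open CategoryTheory

/-! ### Exceptional modules -/

section

universe u

open scoped ModuleCat

variable {k : Type u} [Field k] {A : Type u} [Ring A] [Algebra k A]

/-- A module all of whose endomorphisms are scalars has endomorphism algebra `k`. -/
lemma nonempty_end_algEquiv (M : ModuleCat.{u} A) {x : M} (hx : x ≠ 0)
    (h : ∀ f : M →ₗ[A] M, ∃ c : k, ∀ m, f m = algebraMap k A c • m) :
    Nonempty (End M ≃ₐ[k] k) := by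
  have : Nontrivial (End M) := ⟨1, 0, fun e => hx (congrArg (fun f : M ⟶ M => f.hom x) e)⟩
  refine ⟨(AlgEquiv.ofBijective (Algebra.ofId k (End M)) ⟨(algebraMap k (End M)).injective,
    fun f => ?_⟩).symm⟩
  obtain ⟨c, hc⟩ := h (ModuleCat.Hom.hom f)
  exact ⟨c, ModuleCat.hom_ext (LinearMap.ext fun m => (hc m).symm)⟩

/-- If the endomorphism algebra is `k`, its only idempotents are `0` and `1`. -/
lemma indecomposable_of_end_algEquiv (M : ModuleCat.{u} A) (φ : End M ≃ₐ[k] k) :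
    Indecomposable M := by
  refine ⟨fun h => ?_, fun Y Z i => ?_⟩
  · have : (1 : End M) = 0 := h.eq_of_src _ _
    exact one_ne_zero (α := k) (by rw [← map_one φ, this, map_zero])
  · let p : End M := i.hom ≫ Limits.biprod.fst ≫ Limits.biprod.inl ≫ i.inv
    have hp : p * p = p := by
      change p ≫ p = p
      simp [p]
    have h1 : φ p * φ p = φ p := by rw [← map_mul, hp]
    have h2 : φ p = 0 ∨ φ p = 1 := by
      by_cases h0 : φ p = 0
      · exact Or.inl h0
      · exact Or.inr (mul_right_cancel₀ h0 (h1.trans (one_mul _).symm))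
    rcases h2 with h2 | h2
    · left
      have h3 : (p : M ⟶ M) = 0 := φ.injective (h2.trans (map_zero φ).symm)
      rw [Limits.IsZero.iff_id_eq_zero]
      have : 𝟙 Y = Limits.biprod.inl ≫ i.inv ≫ (p : M ⟶ M) ≫ i.hom ≫ Limits.biprod.fst := by
        simp [p]
      rw [this, h3]
      simp
    · right
      have h3 : (p : M ⟶ M) = 𝟙 M := φ.injective (h2.trans (map_one φ).symm)
      rw [Limits.IsZero.iff_id_eq_zero]
      have : 𝟙 Z = Limits.biprod.inr ≫ i.inv ≫ 𝟙 M ≫ i.hom ≫ Limits.biprod.snd := by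
        simp
      rw [this, ← h3]
      simp [p]

lemma exists_eq_smul_of_end_algEquiv (M : ModuleCat.{u} A) (φ : End M ≃ₐ[k] k)
    (f : M →ₗ[A] M) : ∃ c : k, ∀ m, f m = algebraMap k A c • m := by
  refine ⟨φ (ModuleCat.ofHom f), fun m => ?_⟩
  have : (ModuleCat.ofHom f : End M) = algebraMap k (End M) (φ (ModuleCat.ofHom f)) := by
    apply φ.injective
    rw [AlgEquiv.commutes]
    rfl
  exact congrArg (fun g : M ⟶ M => g.hom m) this

/-- If the endomorphism algebra is `k`, an endomorphism with a nonzero fixed vector is the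
identity. -/
lemma eq_id_of_end_algEquiv (M : ModuleCat.{u} A) (φ : End M ≃ₐ[k] k)
    (f : M →ₗ[A] M) {x : M} (hx : x ≠ 0) (hf : f x = x) (m : M) : f m = m := by
  obtain ⟨c, hc⟩ := exists_eq_smul_of_end_algEquiv M φ f
  have h1 : algebraMap k A (c - 1) • x = 0 := by
    rw [map_sub, sub_smul, ← hc, hf, map_one, one_smul, sub_self]
  have h2 : c = 1 := by
    by_contra h
    have h3 : algebraMap k A ((c - 1)⁻¹ * (c - 1)) • x = 0 := by
      rw [map_mul, mul_smul, h1, smul_zero]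
    rw [inv_mul_cancel₀ (sub_ne_zero.2 h), map_one, one_smul] at h3
    exact hx h3
  rw [hc, h2, map_one, one_smul]

end

namespace LinearNakayama

universe u

variable {k : Type u} [Field k] {n : ℕ}

lemma Simp.exists_scalar {i : Fin n} (f : Simp k i →ₗ[LinearNakayama k n] Simp k i) :
    ∃ c : k, ∀ m, f m = sc k n c • m := by
  refine ⟨(f (Simp.mk i 1)).val, fun m => ?_⟩
  conv_lhs => rw [Simp.mk_eq_smul m, map_smul]
  exact Simp.ext (by simp [mul_comm])

lemma Proj.exists_scalar {i j : Fin n} {h : (i : ℕ) + 1 = j}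
    (f : Proj k i j h →ₗ[LinearNakayama k n] Proj k i j h) :
    ∃ c : k, ∀ m, f m = sc k n c • m := by
  refine ⟨(f (Proj.mk h 1 0)).top, fun m => ?_⟩
  have h0 : (f (Proj.mk h 1 0)).soc = 0 := by
    have := congrArg Proj.soc (Proj.hom_top f)
    rw [Proj.vtx_smul, Proj.soc_mk, if_neg (Proj.src_ne_tgt h)] at this
    exact this.symm
  conv_lhs => rw [Proj.mk_eq_smul m, map_add, map_smul, map_smul, map_smul]
  refine Proj.ext ?_ ?_
  · simp [Proj.sc_smul, Proj.arr_smul, mul_comm]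
  · simp [Proj.sc_smul, Proj.arr_smul, mul_comm, h0]

lemma Simp.finite (i : Fin n) : Module.Finite (LinearNakayama k n) (Simp k i) := by
  refine ⟨⟨{Simp.mk i 1}, eq_top_iff.2 fun x _ => ?_⟩⟩
  rw [Simp.mk_eq_smul x]
  exact Submodule.smul_mem _ _ (Submodule.subset_span (by simp))

lemma Proj.finite {i j : Fin n} (h : (i : ℕ) + 1 = j) :
    Module.Finite (LinearNakayama k n) (Proj k i j h) := by
  refine ⟨⟨{Proj.mk h 1 0}, eq_top_iff.2 fun x _ => ?_⟩⟩
  rw [Proj.mk_eq_smul x]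
  exact Submodule.add_mem _
    (Submodule.smul_mem _ _ (Submodule.subset_span (by simp)))
    (Submodule.smul_mem _ _ (Submodule.smul_mem _ _ (Submodule.subset_span (by simp))))

lemma isExceptional_indec (X : Gen n) : IsExceptional k (indec k X) := by
  have hend : Nonempty (End (indec k X) ≃ₐ[k] k) := by
    cases X with
    | vertex i =>
      exact nonempty_end_algEquiv (simp k i) (Simp.mk_ne_zero (k := k) i) Simp.exists_scalar
    | arrow i j h =>
      exact nonempty_end_algEquiv (proj k i j h) (Proj.mk_ne_zero (k := k) h) Proj.exists_scalar
  obtain ⟨φ⟩ := hend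
  refine ⟨?_, indecomposable_of_end_algEquiv _ φ, ⟨φ⟩, subsingleton_ext_self X⟩
  cases X with
  | vertex i => exact Simp.finite i
  | arrow i j h => exact Proj.finite h

lemma sc_mul_smul {M : Type*} [AddCommGroup M] [Module (LinearNakayama k n) M] (c d : k) (x : M) :
    sc k n (c * d) • x = sc k n c • sc k n d • x := by
  rw [sc, map_mul, mul_smul]

lemma sc_smul_eq_zero {M : Type*} [AddCommGroup M] [Module (LinearNakayama k n) M] {c : k} {x : M}
    (hx : x ≠ 0) (h : sc k n c • x = 0) : c = 0 := by
  by_contra hc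
  have h1 : sc k n (c⁻¹ * c) • x = 0 := by rw [sc, map_mul, mul_smul, h, smul_zero]
  rw [inv_mul_cancel₀ hc, sc, map_one, one_smul] at h1
  exact hx h1

/-- A linear functional that takes the value `1` at a given nonzero vector. It is additive and
commutes with scalars acting through the algebra, so that `M` needs no `k`-module structure. -/
lemma exists_functional (M : ModuleCat.{u} (LinearNakayama k n)) {x : M} (hx : x ≠ 0) :
    ∃ φ : M →+ k, (∀ c m, φ (sc k n c • m) = c * φ m) ∧ φ x = 1 := by
  let _ : Module k M := Module.compHom M (algebraMap k (LinearNakayama k n))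
  obtain ⟨φ, hφ⟩ := Module.Projective.exists_dual_eq_one k hx
  exact ⟨φ.toAddMonoidHom, fun c m => φ.map_smul c m, hφ⟩

/-- If an arrow starting at `i` acts as a nonzero map on a module `M` with `End M = k`, then
`M ≅ P_i`: the idempotent endomorphism `g` of the proof projects `M` to a copy of `P_i`. -/
lemma nonempty_iso_proj (M : ModuleCat.{u} (LinearNakayama k n)) (ψ : End M ≃ₐ[k] k)
    {i j : Fin n} (h : (i : ℕ) + 1 = j) (z : M) (hz : arr k i j h • z ≠ 0) :
    Nonempty (proj k i j h ≅ M) := by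
  have hij := Proj.src_ne_tgt h
  obtain ⟨x, hxz⟩ : ∃ x : M, x = vtx k i • z := ⟨_, rfl⟩
  have hx : vtx k i • x = x := by rw [hxz, vtx_smul_vtx, if_pos rfl]
  have ha : arr k i j h • x ≠ 0 := by rwa [hxz, arr_smul_vtx, if_pos rfl]
  have hx0 : x ≠ 0 := fun e => ha (by rw [e, smul_zero])
  obtain ⟨φ, hφ, hφ1⟩ := exists_functional M ha
  let g : M →ₗ[LinearNakayama k n] M := mkLin
    { toFun := fun m => sc k n (φ (arr k i j h • m)) • x +
        sc k n (φ (vtx k j • m)) • arr k i j h • x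
      map_zero' := by simp
      map_add' := fun m m' => by simp only [smul_add, map_add, add_smul]; abel }
    (fun c m => by
      simp only [AddMonoidHom.coe_mk, ZeroHom.coe_mk]
      rw [smul_sc, smul_sc, hφ, hφ, sc_mul_smul, sc_mul_smul, smul_add])
    (fun v m => by
      simp only [AddMonoidHom.coe_mk, ZeroHom.coe_mk, arr_smul_vtx, vtx_smul_vtx, smul_add,
        smul_sc, vtx_smul_arr]
      have h1 : vtx k v • x = if v = i then x else 0 := by
        rw [← hx, vtx_smul_vtx]
        split_ifs with hv
        · rw [hv]
        · rfl
      rw [h1]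
      by_cases h2 : v = i
      · simp [h2, hij, hij.symm]
      · by_cases h3 : v = j
        · simp [h3, hij.symm]
        · simp [h2, h3, Ne.symm h3])
    (fun v w hvw m => by
      simp only [AddMonoidHom.coe_mk, ZeroHom.coe_mk, smul_add, arr_smul_arr, vtx_smul_arr,
        smul_sc, map_zero, zero_smul, smul_zero, zero_add, add_zero, sc]
      have h1 : arr k v w hvw • x = if v = i then arr k v w hvw • x else 0 := by
        conv_lhs => rw [← hx, arr_smul_vtx]
        split_ifs with h2 h3 h3 <;> first | rfl | (exfalso; omega)
      by_cases hv : v = i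
      · subst hv
        obtain rfl : w = j := Fin.ext (by omega)
        simp
      · rw [h1, if_neg hv, if_neg (by omega)]
        simp)
  have hg : ∀ m, g m = sc k n (φ (arr k i j h • m)) • x +
      sc k n (φ (vtx k j • m)) • arr k i j h • x := fun m => rfl
  have hgx : g x = x := by
    rw [hg, hφ1]
    have : vtx k j • x = 0 := by rw [← hx, vtx_smul_vtx, if_neg hij.symm]
    simp [this]
  have hid := eq_id_of_end_algEquiv M ψ g hx0 hgx
  refine ⟨(LinearEquiv.ofBijective (Proj.hom x hx : Proj k i j h →ₗ[LinearNakayama k n] M)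
    ⟨(injective_iff_map_eq_zero _).2 fun y hy => ?_, fun m => ?_⟩).toModuleIso⟩
  · rw [Proj.hom_apply] at hy
    have h1 : y.top = 0 := by
      refine sc_smul_eq_zero (n := n) ha ?_
      have := congrArg (fun m : M => arr k i j h • m) hy
      simpa only [smul_add, smul_sc, arr_smul_arr, smul_zero, add_zero] using this
    have h2 : y.soc = 0 := by
      refine sc_smul_eq_zero (n := n) ha ?_
      simpa [h1] using hy
    exact Proj.ext h1 h2
  · refine ⟨Proj.mk h (φ (arr k i j h • m)) (φ (vtx k j • m)), ?_⟩
    rw [Proj.hom_apply]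
    exact (hg m).symm.trans (hid m)

/-- If all arrows act as zero on a module `M` with `End M = k` and `M` has a nonzero vector at the
vertex `i`, then `M ≅ S_i`: the endomorphism `g` of the proof projects `M` to the span of this
vector. -/
lemma nonempty_iso_simp (M : ModuleCat.{u} (LinearNakayama k n)) (ψ : End M ≃ₐ[k] k)
    (hM : ∀ (i j : Fin n) h (m : M), arr k i j h • m = 0) {i : Fin n} (z : M)
    (hz : vtx k i • z ≠ 0) : Nonempty (simp k i ≅ M) := by
  obtain ⟨x, hxz⟩ : ∃ x : M, x = vtx k i • z := ⟨_, rfl⟩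
  have hx : vtx k i • x = x := by rw [hxz, vtx_smul_vtx, if_pos rfl]
  have hx0 : x ≠ 0 := by rwa [hxz]
  obtain ⟨φ, hφ, hφ1⟩ := exists_functional M hx0
  let g : M →ₗ[LinearNakayama k n] M := mkLin
    { toFun := fun m => sc k n (φ (vtx k i • m)) • x
      map_zero' := by simp
      map_add' := fun m m' => by simp only [smul_add, map_add, add_smul] }
    (fun c m => by
      simp only [AddMonoidHom.coe_mk, ZeroHom.coe_mk]
      rw [smul_sc, hφ, sc_mul_smul])
    (fun v m => by
      simp only [AddMonoidHom.coe_mk, ZeroHom.coe_mk, vtx_smul_vtx, smul_sc]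
      have h1 : vtx k v • x = if v = i then x else 0 := by
        rw [← hx, vtx_smul_vtx]
        split_ifs with hv
        · rw [hv]
        · rfl
      rw [h1]
      by_cases h2 : v = i
      · simp [h2]
      · simp [h2, Ne.symm h2])
    (fun v w hvw m => by
      simp only [hM, map_zero])
  have hg : ∀ m, g m = sc k n (φ (vtx k i • m)) • x := fun m => rfl
  have hgx : g x = x := by
    rw [hg, hx, hφ1]
    simp
  have hid := eq_id_of_end_algEquiv M ψ g hx0 hgx
  refine ⟨(LinearEquiv.ofBijective (Simp.hom x hx fun j h => hM i j h x :
    Simp k i →ₗ[LinearNakayama k n] M)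
    ⟨(injective_iff_map_eq_zero _).2 fun y hy => ?_, fun m => ?_⟩).toModuleIso⟩
  · rw [Simp.hom_apply] at hy
    exact Simp.ext (sc_smul_eq_zero hx0 hy)
  · refine ⟨Simp.mk i (φ (vtx k i • m)), ?_⟩
    rw [Simp.hom_apply]
    exact (hg m).symm.trans (hid m)

/-- Every module with endomorphism algebra `k`, in particular every exceptional module, is one of
the modules `indec k X`. -/
lemma exists_iso_indec (M : ModuleCat.{u} (LinearNakayama k n)) (ψ : End M ≃ₐ[k] k) :
    ∃ X : Gen n, Nonempty (indec k X ≅ M) := by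
  by_cases h : ∃ (i j : Fin n) (h : (i : ℕ) + 1 = j) (z : M), arr k i j h • z ≠ 0
  · obtain ⟨i, j, h, z, hz⟩ := h
    exact ⟨.arrow i j h, nonempty_iso_proj M ψ h z hz⟩
  · push Not at h
    by_cases h' : ∃ (i : Fin n) (z : M), vtx k i • z ≠ 0
    · obtain ⟨i, z, hz⟩ := h'
      exact ⟨.vertex i, nonempty_iso_simp M ψ h z hz⟩
    · push Not at h'
      exfalso
      refine (indecomposable_of_end_algEquiv M ψ).1 ?_
      refine @ModuleCat.isZero_of_subsingleton _ _ M (subsingleton_of_forall_eq 0 fun m => ?_)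
      rw [← one_smul (LinearNakayama k n) m, ← sum_vtx, Finset.sum_smul]
      exact Finset.sum_eq_zero fun i _ => h' i m

lemma isExceptionalPair_indec_iff (X Y : Gen n) :
    IsExceptionalPair k (indec k X) (indec k Y) ↔ ¬ NonOrth Y X := by
  rw [nonOrth_iff_ext (k := k)]
  push Not
  constructor
  · intro h s
    rcases Nat.eq_zero_or_pos s with rfl | hs
    · exact (subsingleton_ext_zero_iff _ _).2 h.hom_eq_zero
    · exact h.ext_eq_zero s hs
  · intro h
    exact ⟨isExceptional_indec X, isExceptional_indec Y, (subsingleton_ext_zero_iff _ _).1 (h 0),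
      fun s _ => h s⟩

/-- Complete exceptional sequences correspond to valid sequences of labels. -/
lemma exceptionalSequences_eq_image :
    exceptionalSequences k (LinearNakayama k n) n =
      (fun (X : Fin n → Gen n) p =>
        (Quotient.mk (isIsomorphicSetoid (ModuleCat.{u} (LinearNakayama k n))) (indec k (X p)))) ''
        validSequences n := by
  ext E
  constructor
  · rintro ⟨M, hM, hE⟩
    choose X hX using fun p => exists_iso_indec (M p) (hM.exceptional p).end_equiv.some
    refine ⟨X, fun p q hpq hn => ?_, funext fun p => ?_⟩
    · obtain ⟨s, hs⟩ := (nonOrth_iff_ext (k := k) _ _).1 hn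
      refine hs (subsingleton_ext_of_iso (hX q).some.symm (hX p).some.symm s ?_)
      have hp := hM.pair p q hpq
      rcases Nat.eq_zero_or_pos s with rfl | hs
      · exact (subsingleton_ext_zero_iff _ _).2 hp.hom_eq_zero
      · exact hp.ext_eq_zero s hs
    · rw [hE p]
      exact Quotient.sound (hX p)
  · rintro ⟨X, hX, rfl⟩
    exact ⟨fun p => indec k (X p), ⟨fun p => isExceptional_indec _, fun p q hpq =>
      (isExceptionalPair_indec_iff _ _).2 (hX p q hpq)⟩, fun p => rfl⟩

lemma encard_exceptionalSequences :
    (exceptionalSequences k (LinearNakayama k n) n).encard =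
      Nat.card {f : Fin n → Fin n // f ∘ f = f} := by
  rw [exceptionalSequences_eq_image, ← encard_validSequences]
  refine Function.Injective.encard_image (fun X Y h => funext fun p => ?_) _
  obtain ⟨e⟩ := Quotient.exact (congrFun h p)
  exact eq_of_iso e

end LinearNakayama

theorem mainTheorem2 (k : Type*) [Field k] [IsAlgClosed k] (n : ℕ) (hn : 1 ≤ n) :
    (exceptionalSequences k (LinearNakayama k n) n).encard =
        ((∑ j ∈ Finset.Icc 1 n, n.choose j * j ^ (n - j) : ℕ) : ℕ∞) ∧
      Nat.card {f : Fin n → Fin n // f ∘ f = f} =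
        ∑ j ∈ Finset.Icc 1 n, n.choose j * j ^ (n - j) := by
  refine ⟨?_, LinearNakayama.card_idempotents n hn⟩
  rw [LinearNakayama.encard_exceptionalSequences, LinearNakayama.card_idempotents n hn]
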